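/- Let $(E,\sigma)$ be a real symplectic vector space (of arbitrary, possibly infinite, dimension) and let $\hbar\in[0,1]$. Let $\Delta(E,\hbar\sigma)$ be the unital $*$-algebra with linear basis $W_\hbar(F)$, $F\in E$, and $$W_\hbar(F)W_\hbar(G)=e^{-\frac{i\hbar}{2}\sigma(F,G)}W_\hbar(F+G),\qquad W_\hbar(F)^*=W_\hbar(-F),$$ and let the Weyl algebra $\mathcal W(E,\hbar\sigma)$ be its completion in the minimal regular norm $\|A\|=\sup_\omega\omega(A^*A)^{1/2}$, the supremum being over all states $\omega$ of $\Delta(E,\hbar\sigma)$. A state $\omega$ of $\mathcal W(E,\hbar\sigma)$ is called regular if $t\mapsto\omega(W_\hbar(tF))$ is continuous on $\mathbb R$ for every $F\in E$. Let $V_\hbar\subseteq\mathcal W(E,\hbar\sigma)^*$, the space of regular functionals, be the complex linear span of the regular states, let $\overline V_\hbar$ be the weak* closure of $V_\hbar$ in $\mathcal W(E,\hbar\sigma)^{***}$, and let $N(\overline V_\hbar)=\{\Phi\in\mathcal W(E,\hbar\sigma)^{**}:\xi(\Phi)=0\text{ for all }\xi\in\overline V_\hbar\}$. Then, with the operations induced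 by the vector space structure, the (Arens) product and the involution of the bidual and with the quotient norm, $\mathfrak A_\hbar:=\mathcal W(E,\hbar\sigma)^{**}/N(\overline V_\hbar)$ is a well-defined C*-algebra, and it is a W*-algebra with predual $(\mathfrak A_\hbar)_*=V_\hbar$: the space $V_\hbar$ is complete in the norm of $\mathcal W(E,\hbar\sigma)^*$, and the pairing $\langle\Phi+N(\overline V_\hbar),\omega\rangle=\Phi(\omega)$ is well defined and induces an isometric linear isomorphism of $\mathfrak A_\hbar$ onto the Banach space dual $(V_\hbar)^*$. -/

import Mathlib

open scoped ComplexOrder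

universe u

noncomputable section

/-! ### Symplectic forms and the twisted group algebra `Δ(E, ħσ)` -/

/-- A symplectic form on a real vector space (of arbitrary dimension): a bilinear form that is
alternating and (weakly) non-degenerate. -/
structure SymplecticForm (E : Type u) [AddCommGroup E] [Module ℝ E] where
  /-- the bilinear form `σ` -/
  form : E →ₗ[ℝ] E →ₗ[ℝ] ℝ
  alt : ∀ F, form F F = 0
  nondegenerate : ∀ F, (∀ G, form F G = 0) → F = 0

namespace SymplecticForm

variable {E : Type u} [AddCommGroup E] [Module ℝ E] (σ : SymplecticForm E)

lemma form_swap (F G : E) : σ.form F G = -σ.form G F := by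
  have h := σ.alt (F + G)
  simp only [map_add, LinearMap.add_apply, σ.alt] at h
  linarith

/-- The multiplier `e^{-iħσ(F,G)/2}` of the Weyl relations. -/
def phase (ħ : ℝ) (F G : E) : ℂ :=
  Complex.exp (-(Complex.I * ħ / 2) * (σ.form F G : ℝ))

lemma phase_zero_left (ħ : ℝ) (G : E) : σ.phase ħ 0 G = 1 := by simp [phase]

lemma phase_zero_right (ħ : ℝ) (F : E) : σ.phase ħ F 0 = 1 := by simp [phase]

lemma phase_neg_self (ħ : ℝ) (F : E) : σ.phase ħ (-F) F = 1 := by simp [phase, σ.alt]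

lemma phase_cocycle (ħ : ℝ) (F G H : E) :
    σ.phase ħ F G * σ.phase ħ (F + G) H = σ.phase ħ G H * σ.phase ħ F (G + H) := by
  simp only [phase, ← Complex.exp_add, map_add, LinearMap.add_apply]
  congr 1
  push_cast
  ring

lemma star_phase (ħ : ℝ) (F G : E) : star (σ.phase ħ F G) = σ.phase ħ (-G) (-F) := by
  simp only [phase, Complex.star_def, ← Complex.exp_conj, map_neg, LinearMap.neg_apply, neg_neg,
    map_mul, map_div₀, Complex.conj_I, Complex.conj_ofReal, σ.form_swap G F]
  congr 1
  rw [Complex.conj_ofNat]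
  push_cast
  ring

end SymplecticForm

section Twisted

variable {E : Type u} [AddCommGroup E] [Module ℝ E]

/-- The *-algebra `Δ(E, ħσ)`: the complex vector space with basis the Weyl elements
`W(F)`, `F ∈ E`, with `W(F) W(G) = e^{-iħσ(F,G)/2} W(F+G)` and `W(F)* = W(-F)`. -/
@[nolint unusedArguments]
def WeylSpan (_σ : SymplecticForm E) (_ħ : ℝ) : Type u := E →₀ ℂ

namespace WeylSpan

variable (σ : SymplecticForm E) (ħ : ℝ)

instance instAddCommGroup : AddCommGroup (WeylSpan σ ħ) := inferInstanceAs (AddCommGroup (E →₀ ℂ))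
instance : Module ℂ (WeylSpan σ ħ) := inferInstanceAs (Module ℂ (E →₀ ℂ))

/-- The multiple `c • W(F)` of a Weyl element. -/
def single (F : E) (c : ℂ) : WeylSpan σ ħ := (Finsupp.single F c : E →₀ ℂ)

/-- The Weyl element `W(F)` of `Δ(E, ħσ)`. -/
def weyl (F : E) : WeylSpan σ ħ := single σ ħ F 1

variable {σ ħ}

lemma single_add (F : E) (c d : ℂ) :
    single σ ħ F (c + d) = single σ ħ F c + single σ ħ F d :=
  Finsupp.single_add F c d

lemma smul_single (F : E) (c d : ℂ) : c • single σ ħ F d = single σ ħ F (c * d) :=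
  Finsupp.smul_single' c F d

@[elab_as_elim]
lemma induction {p : WeylSpan σ ħ → Prop} (a : WeylSpan σ ħ) (h0 : p 0)
    (hadd : ∀ a b, p a → p b → p (a + b)) (hs : ∀ F c, p (single σ ħ F c)) : p a :=
  Finsupp.induction_linear (motive := p) a h0 hadd hs

variable (σ ħ)

/-- The multiplication of `Δ(E, ħσ)`, as a bilinear map. -/
def mulBilin : WeylSpan σ ħ →ₗ[ℂ] WeylSpan σ ħ →ₗ[ℂ] WeylSpan σ ħ :=
  Finsupp.linearCombination ℂ fun F : E =>
    (Finsupp.linearCombination ℂ fun G : E => single σ ħ (F + G) (σ.phase ħ F G) :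
      (E →₀ ℂ) →ₗ[ℂ] WeylSpan σ ħ)

variable {σ ħ}

instance : Mul (WeylSpan σ ħ) := ⟨fun a b => mulBilin σ ħ a b⟩
instance : One (WeylSpan σ ħ) := ⟨weyl σ ħ 0⟩

lemma one_def : (1 : WeylSpan σ ħ) = single σ ħ 0 1 := rfl

lemma mul_def (a b : WeylSpan σ ħ) : a * b = mulBilin σ ħ a b := rfl

lemma single_mul_single (F G : E) (c d : ℂ) :
    single σ ħ F c * single σ ħ G d = single σ ħ (F + G) (c * d * σ.phase ħ F G) := by
  have h : mulBilin σ ħ (single σ ħ F c) (single σ ħ G d) =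
      c • d • single σ ħ (F + G) (σ.phase ħ F G) := by
    have h1 : mulBilin σ ħ (single σ ħ F c) =
        c • (Finsupp.linearCombination ℂ fun G : E => single σ ħ (F + G) (σ.phase ħ F G) :
          (E →₀ ℂ) →ₗ[ℂ] WeylSpan σ ħ) :=
      Finsupp.linearCombination_single ℂ c F
    rw [h1]
    exact congrArg (fun x : WeylSpan σ ħ => c • x) (Finsupp.linearCombination_single ℂ d G)
  rw [mul_def, h, smul_single, smul_single, mul_assoc]

private lemma add_mul' (a b c : WeylSpan σ ħ) : (a + b) * c = a * c + b * c := by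
  simp [mul_def]

private lemma mul_add' (a b c : WeylSpan σ ħ) : a * (b + c) = a * b + a * c := by
  simp [mul_def]

private lemma zero_mul' (a : WeylSpan σ ħ) : 0 * a = 0 := by simp [mul_def]

private lemma mul_zero' (a : WeylSpan σ ħ) : a * 0 = 0 := by simp [mul_def]

private lemma mul_assoc' (a b c : WeylSpan σ ħ) : a * b * c = a * (b * c) := by
  induction a using induction with
  | h0 => simp only [zero_mul']
  | hadd a a' h h' => simp only [add_mul', h, h']
  | hs F x =>
    induction b using induction with
    | h0 => simp only [zero_mul', mul_zero']
    | hadd b b' h h' => simp only [add_mul', mul_add', h, h']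
    | hs G y =>
      induction c using induction with
      | h0 => simp only [mul_zero']
      | hadd c c' h h' => simp only [mul_add', h, h']
      | hs H z =>
        simp only [single_mul_single, add_assoc]
        congr 1
        linear_combination x * y * z * σ.phase_cocycle ħ F G H

private lemma one_mul' (a : WeylSpan σ ħ) : 1 * a = a := by
  induction a using induction with
  | h0 => simp only [mul_zero']
  | hadd a a' h h' => simp only [mul_add', h, h']
  | hs F x => simp [one_def, single_mul_single, σ.phase_zero_left]

private lemma mul_one' (a : WeylSpan σ ħ) : a * 1 = a := by
  induction a using induction with
  | h0 => simp only [zero_mul']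
  | hadd a a' h h' => simp only [add_mul', h, h']
  | hs F x => simp [one_def, single_mul_single, σ.phase_zero_right]

instance : Ring (WeylSpan σ ħ) where
  __ := instAddCommGroup σ ħ
  mul_assoc := mul_assoc'
  one_mul := one_mul'
  mul_one := mul_one'
  left_distrib := mul_add'
  right_distrib := add_mul'
  zero_mul := zero_mul'
  mul_zero := mul_zero'

instance : Algebra ℂ (WeylSpan σ ħ) :=
  Algebra.ofModule (fun r a b => by simp [mul_def]) (fun r a b => by simp [mul_def])

/-- The involution, the conjugate-linear extension of `W(F)* = W(-F)`. -/
instance : Star (WeylSpan σ ħ) :=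
  ⟨fun a => ((Finsupp.mapDomain (fun F : E => -F) (show E →₀ ℂ from a)).mapRange star
    (star_zero ℂ) : E →₀ ℂ)⟩

lemma star_single (F : E) (c : ℂ) : star (single σ ħ F c) = single σ ħ (-F) (star c) := by
  change ((Finsupp.mapDomain (fun F : E => -F) (Finsupp.single F c)).mapRange star
    (star_zero ℂ) : E →₀ ℂ) = Finsupp.single (-F) (star c)
  simp

private lemma star_add' (a b : WeylSpan σ ħ) : star (a + b) = star a + star b := by
  change ((Finsupp.mapDomain (fun F : E => -F) ((show E →₀ ℂ from a) + (show E →₀ ℂ from b))).mapRange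
    star (star_zero ℂ) : E →₀ ℂ) = _
  rw [Finsupp.mapDomain_add, Finsupp.mapRange_add (fun x y => star_add x y)]
  rfl

private lemma star_zero' : star (0 : WeylSpan σ ħ) = 0 := by
  have := star_add' (σ := σ) (ħ := ħ) 0 0
  simpa using this

instance : StarRing (WeylSpan σ ħ) where
  star_involutive a := by
    induction a using induction with
    | h0 => simp only [star_zero']
    | hadd a b ha hb => simp only [star_add', ha, hb]
    | hs F c => simp [star_single]
  star_mul a b := by
    induction a using induction with
    | h0 => simp only [star_zero', zero_mul, mul_zero]
    | hadd a a' h h' => simp only [star_add', add_mul, mul_add, h, h']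
    | hs F x =>
      induction b using induction with
      | h0 => simp only [star_zero', zero_mul, mul_zero]
      | hadd b b' h h' => simp only [star_add', add_mul, mul_add, h, h']
      | hs G y =>
        simp only [single_mul_single, star_single, neg_add_rev, star_mul', σ.star_phase]
        congr 1
        ring
  star_add := star_add'

instance : StarModule ℂ (WeylSpan σ ħ) where
  star_smul c a := by
    induction a using induction with
    | h0 => simp
    | hadd a b ha hb => simp only [smul_add, star_add, ha, hb]
    | hs F x => simp [star_single, smul_single]

end WeylSpan

end Twisted

/-! ### States and the minimal regular norm -/

section States

variable {A : Type*} [Ring A] [StarRing A] [Algebra ℂ A]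

/-- A state of a unital complex *-algebra: a positive, normalised linear functional. -/
structure IsState (ω : A →ₗ[ℂ] ℂ) : Prop where
  nonneg : ∀ a, 0 ≤ ω (star a * a)
  map_one : ω 1 = 1

/-- The seminorm `a ↦ ω(a* a)^{1/2}` of a functional `ω`. -/
def stateNorm (ω : A →ₗ[ℂ] ℂ) (a : A) : ℝ := √(ω (star a * a)).re

lemma stateNorm_nonneg (ω : A →ₗ[ℂ] ℂ) (a : A) : 0 ≤ stateNorm ω a := Real.sqrt_nonneg _

/-- For a state `ω` and `ω(b* b) ≠ 0`, the functional `a ↦ ω(b* a b) / ω(b* b)`. -/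
def conjState (ω : A →ₗ[ℂ] ℂ) (b : A) : A →ₗ[ℂ] ℂ :=
  (ω (star b * b))⁻¹ • (ω ∘ₗ LinearMap.mulLeft ℂ (star b) ∘ₗ LinearMap.mulRight ℂ b)

lemma conjState_apply (ω : A →ₗ[ℂ] ℂ) (b a : A) :
    conjState ω b a = (ω (star b * b))⁻¹ * ω (star b * (a * b)) := by
  simp [conjState]

lemma IsState.conjState {ω : A →ₗ[ℂ] ℂ} (h : IsState ω) {b : A} (hb : ω (star b * b) ≠ 0) :
    IsState (conjState ω b) where
  nonneg a := by
    rw [conjState_apply]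
    have h1 : star b * (star a * a * b) = star (a * b) * (a * b) := by simp [mul_assoc]
    rw [h1]
    exact mul_nonneg (inv_nonneg.2 (h.nonneg b)) (h.nonneg _)
  map_one := by simp [conjState_apply, hb]

lemma IsState.stateNorm_mul {ω : A →ₗ[ℂ] ℂ} (h : IsState ω) {b : A}
    (hb : ω (star b * b) ≠ 0) (a : A) :
    stateNorm ω (a * b) = stateNorm (_root_.conjState ω b) a * stateNorm ω b := by
  have h1 : star b * (star a * a * b) = star (a * b) * (a * b) := by simp [mul_assoc]
  rw [stateNorm, stateNorm, stateNorm,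
    ← Real.sqrt_mul (Complex.nonneg_iff.1 ((h.conjState hb).nonneg a)).1, conjState_apply, h1]
  congr 1
  have h2 := (Complex.nonneg_iff.1 (h.nonneg b)).2
  have h3 : ω (star b * b) = ((ω (star b * b)).re : ℂ) := Complex.ext (by simp) (by simp [← h2])
  have h4 : (ω (star b * b)).re ≠ 0 := fun h0 => hb (by rw [h3, h0]; simp)
  rw [h3, ← Complex.ofReal_inv, Complex.re_ofReal_mul, Complex.ofReal_re]
  field_simp

variable [StarModule ℂ A]

lemma IsState.map_star {ω : A →ₗ[ℂ] ℂ} (h : IsState ω) (a : A) : ω (star a) = star (ω a) := by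
  have h1 := (Complex.nonneg_iff.1 (h.nonneg (a + algebraMap ℂ A 1))).2
  have h2 := (Complex.nonneg_iff.1 (h.nonneg (a + algebraMap ℂ A Complex.I))).2
  have h3 := (Complex.nonneg_iff.1 (h.nonneg a)).2
  simp only [Algebra.algebraMap_eq_smul_one, star_add, star_smul, star_one, add_mul, mul_add,
    smul_mul_assoc, mul_smul_comm, one_mul, mul_one, map_add, map_smul, h.map_one,
    Complex.add_im] at h1 h2
  apply Complex.ext <;> simp at h1 h2 ⊢ <;> linarith

/-- The semi-inner product `⟨a, b⟩ = ω(a* b)` of a state. -/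
abbrev IsState.core {ω : A →ₗ[ℂ] ℂ} (h : IsState ω) : PreInnerProductSpace.Core ℂ A where
  inner a b := ω (star a * b)
  conj_inner_symm a b := by
    change star (ω (star b * a)) = _
    rw [← h.map_star]
    simp
  re_inner_nonneg a := (Complex.nonneg_iff.1 (h.nonneg a)).1
  add_left a b c := by simp [add_mul]
  smul_left a b c := by simp

lemma IsState.stateNorm_add_le {ω : A →ₗ[ℂ] ℂ} (h : IsState ω) (a b : A) :
    stateNorm ω (a + b) ≤ stateNorm ω a + stateNorm ω b := by
  let _ := h.core
  let _ := InnerProductSpace.Core.toSeminormedAddCommGroup (𝕜 := ℂ) (F := A)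
  exact norm_add_le a b

lemma IsState.norm_apply_le {ω : A →ₗ[ℂ] ℂ} (h : IsState ω) (a b : A) :
    ‖ω (star a * b)‖ ≤ stateNorm ω a * stateNorm ω b := by
  let _ := h.core
  exact InnerProductSpace.Core.norm_inner_le_norm (𝕜 := ℂ) a b

lemma stateNorm_smul (ω : A →ₗ[ℂ] ℂ) (c : ℂ) (a : A) :
    stateNorm ω (c • a) = ‖c‖ * stateNorm ω a := by
  have : ω (star (c • a) * (c • a)) = ((‖c‖ ^ 2 : ℝ) : ℂ) * ω (star a * a) := by
    simp only [star_smul, smul_mul_assoc, mul_smul_comm, map_smul, smul_eq_mul, ← mul_assoc]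
    congr 1
    rw [Complex.star_def, Complex.mul_conj, Complex.normSq_eq_norm_sq]
  rw [stateNorm, this, Complex.re_ofReal_mul, Real.sqrt_mul (by positivity),
    Real.sqrt_sq (norm_nonneg c), stateNorm]

end States

namespace WeylSpan

variable {E : Type u} [AddCommGroup E] [Module ℝ E] (σ : SymplecticForm E) (ħ : ℝ)

/-- The minimal regular norm on `Δ(E, ħσ)`: the supremum of `ω(a* a)^{1/2}` over all states `ω`
of the *-algebra `Δ(E, ħσ)`. -/
def minimalRegularNorm (a : WeylSpan σ ħ) : ℝ :=
  ⨆ ω : {ω : WeylSpan σ ħ →ₗ[ℂ] ℂ // IsState ω}, stateNorm ω.1 a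

/-- The tracial state, `W(F) ↦ δ_{F,0}`. -/
def traceFunctional : WeylSpan σ ħ →ₗ[ℂ] ℂ := Finsupp.lapply (0 : E)

variable {σ ħ}

lemma traceFunctional_star_mul (a b : WeylSpan σ ħ) :
    traceFunctional σ ħ (star a * b) =
      Finsupp.linearCombination ℂ (fun F : E => star ((show E →₀ ℂ from a) F))
        (show E →₀ ℂ from b) := by
  induction b using induction with
  | h0 =>
    rw [mul_zero, map_zero]
    exact (map_zero (Finsupp.linearCombination ℂ _)).symm
  | hadd b b' h h' =>
    rw [mul_add, map_add, h, h']
    exact (map_add (Finsupp.linearCombination ℂ _) _ _).symm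
  | hs G y =>
    refine Eq.trans ?_ (Finsupp.linearCombination_single ℂ y G).symm
    induction a using induction with
    | h0 =>
      rw [star_zero, zero_mul, map_zero]
      exact (by simp : (0 : ℂ) = y • star (0 : ℂ))
    | hadd a a' h h' =>
      rw [star_add, add_mul, map_add, h, h', ← smul_add, ← star_add]
      rfl
    | hs F x =>
      rw [star_single, single_mul_single]
      change (Finsupp.single (-F + G) (star x * y * σ.phase ħ (-F) G) : E →₀ ℂ) 0 =
        y • star ((Finsupp.single F x : E →₀ ℂ) G)
      classical
      by_cases hFG : F = G
      · subst hFG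
        simp [σ.phase_neg_self, mul_comm]
      · have : -F + G ≠ 0 := fun h0 => hFG (by rwa [neg_add_eq_zero] at h0)
        simp [hFG, this]

lemma traceFunctional_star_mul_self (a : WeylSpan σ ħ) :
    traceFunctional σ ħ (star a * a) =
      ((∑ F ∈ (show E →₀ ℂ from a).support, ‖(show E →₀ ℂ from a) F‖ ^ 2 : ℝ) : ℂ) := by
  rw [traceFunctional_star_mul, Finsupp.linearCombination_apply, Finsupp.sum]
  push_cast
  refine Finset.sum_congr rfl fun F _ => ?_
  rw [smul_eq_mul, Complex.star_def, Complex.mul_conj, Complex.normSq_eq_norm_sq]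
  push_cast
  rfl

lemma isState_traceFunctional : IsState (traceFunctional σ ħ) where
  nonneg a := by
    rw [traceFunctional_star_mul_self]
    exact_mod_cast Finset.sum_nonneg fun _ _ => by positivity
  map_one := by
    change (Finsupp.single (0 : E) (1 : ℂ) : E →₀ ℂ) 0 = 1
    simp

instance : Nonempty {ω : WeylSpan σ ħ →ₗ[ℂ] ℂ // IsState ω} :=
  ⟨⟨_, isState_traceFunctional⟩⟩

lemma stateNorm_single {ω : WeylSpan σ ħ →ₗ[ℂ] ℂ} (h : IsState ω) (F : E) (c : ℂ) :
    stateNorm ω (single σ ħ F c) = ‖c‖ := by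
  have h1 : single σ ħ F c = c • weyl σ ħ F := by rw [weyl, smul_single, mul_one]
  have h2 : star (weyl σ ħ F) * weyl σ ħ F = 1 := by
    rw [weyl, star_single, single_mul_single, one_def]
    simp [σ.phase_neg_self]
  rw [h1, stateNorm_smul, stateNorm, h2, h.map_one]
  simp

lemma bddAbove_stateNorm (a : WeylSpan σ ħ) :
    BddAbove (Set.range fun ω : {ω : WeylSpan σ ħ →ₗ[ℂ] ℂ // IsState ω} => stateNorm ω.1 a) := by
  suffices h : ∃ C, ∀ ω : WeylSpan σ ħ →ₗ[ℂ] ℂ, IsState ω → stateNorm ω a ≤ C by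
    obtain ⟨C, hC⟩ := h
    exact ⟨C, by rintro _ ⟨ω, rfl⟩; exact hC ω.1 ω.2⟩
  induction a using induction with
  | h0 => exact ⟨0, fun ω _ => by simp [stateNorm]⟩
  | hadd a b ha hb =>
    obtain ⟨C, hC⟩ := ha
    obtain ⟨D, hD⟩ := hb
    exact ⟨C + D, fun ω h => (h.stateNorm_add_le a b).trans (add_le_add (hC ω h) (hD ω h))⟩
  | hs F c => exact ⟨‖c‖, fun ω h => (stateNorm_single h F c).le⟩

lemma stateNorm_le {ω : WeylSpan σ ħ →ₗ[ℂ] ℂ} (h : IsState ω) (a : WeylSpan σ ħ) :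
    stateNorm ω a ≤ minimalRegularNorm σ ħ a :=
  le_ciSup (bddAbove_stateNorm a) ⟨ω, h⟩

lemma minimalRegularNorm_nonneg (a : WeylSpan σ ħ) : 0 ≤ minimalRegularNorm σ ħ a :=
  (stateNorm_nonneg _ _).trans (stateNorm_le isState_traceFunctional a)

lemma minimalRegularNorm_mul_le (a b : WeylSpan σ ħ) :
    minimalRegularNorm σ ħ (a * b) ≤ minimalRegularNorm σ ħ a * minimalRegularNorm σ ħ b := by
  refine ciSup_le fun ω => ?_
  by_cases hb : ω.1 (star b * b) = 0
  · have h1 : stateNorm ω.1 b = 0 := by simp [stateNorm, hb]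
    have h2 := ω.2.norm_apply_le (star a * (a * b)) b
    rw [h1, mul_zero] at h2
    have h3 : star (star a * (a * b)) * b = star (a * b) * (a * b) := by simp [mul_assoc]
    rw [h3] at h2
    have h4 : ω.1 (star (a * b) * (a * b)) = 0 := norm_le_zero_iff.1 h2
    have h5 : stateNorm ω.1 (a * b) = 0 := by rw [stateNorm, h4]; simp
    rw [h5]
    exact mul_nonneg (minimalRegularNorm_nonneg a) (minimalRegularNorm_nonneg b)
  · rw [ω.2.stateNorm_mul hb]
    exact mul_le_mul (stateNorm_le (ω.2.conjState hb) a) (stateNorm_le ω.2 b)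
      (stateNorm_nonneg _ _) (minimalRegularNorm_nonneg a)

variable (σ ħ)

/-- The minimal regular norm, bundled as a ring norm. -/
def ringNorm : RingNorm (WeylSpan σ ħ) where
  toFun := minimalRegularNorm σ ħ
  map_zero' := by simp [minimalRegularNorm, stateNorm]
  add_le' a b := ciSup_le fun ω =>
    (ω.2.stateNorm_add_le a b).trans (add_le_add (stateNorm_le ω.2 a) (stateNorm_le ω.2 b))
  neg' a := by simp [minimalRegularNorm, stateNorm]
  mul_le' := minimalRegularNorm_mul_le
  eq_zero_of_map_eq_zero' a ha := by
    have h1 := stateNorm_le isState_traceFunctional a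
    have h2 : minimalRegularNorm σ ħ a = 0 := ha
    rw [h2, stateNorm, traceFunctional_star_mul_self, Complex.ofReal_re] at h1
    have h3 := Real.sqrt_eq_zero'.1 (le_antisymm h1 (Real.sqrt_nonneg _))
    have h4 := (Finset.sum_eq_zero_iff_of_nonneg (fun _ _ => by positivity)).1
      (le_antisymm h3 (Finset.sum_nonneg fun _ _ => by positivity))
    refine Finsupp.ext (f := (show E →₀ ℂ from a)) (g := 0) fun F => ?_
    by_contra hF
    have h5 := h4 F (Finsupp.mem_support_iff.2 hF)
    exact hF (by simpa using h5)

instance : NormedRing (WeylSpan σ ħ) := (ringNorm σ ħ).toNormedRing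

variable {σ ħ}

lemma norm_def (a : WeylSpan σ ħ) : ‖a‖ = minimalRegularNorm σ ħ a := rfl

instance : NormedAlgebra ℂ (WeylSpan σ ħ) where
  norm_smul_le c a := by
    refine ciSup_le fun ω => ?_
    rw [stateNorm_smul]
    exact mul_le_mul_of_nonneg_left (stateNorm_le ω.2 a) (norm_nonneg c)

instance : CStarRing (WeylSpan σ ħ) where
  norm_mul_self_le a := by
    have h : ‖a‖ ≤ √‖star a * a‖ := by
      refine ciSup_le fun ω => Real.sqrt_le_sqrt ?_
      have h1 := ω.2.norm_apply_le 1 (star a * a)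
      have h2 : stateNorm ω.1 1 = 1 := by simp [stateNorm, ω.2.map_one]
      rw [star_one, one_mul, h2, one_mul] at h1
      exact (Complex.re_le_norm _).trans (h1.trans (stateNorm_le ω.2 _))
    have h3 := mul_le_mul h h (norm_nonneg a) (Real.sqrt_nonneg _)
    rwa [Real.mul_self_sqrt (norm_nonneg _)] at h3

end WeylSpan

/-! ### The Weyl algebra -/

section CompletionStar

open UniformSpace

/-- The continuous extension of the involution to the completion. -/
instance completionStar (A : Type*) [NormedRing A] [StarRing A] : Star (Completion A) :=
  ⟨Completion.map star⟩

lemma completion_continuous_star {A : Type*} [NormedRing A] [StarRing A] :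
    Continuous (star : Completion A → Completion A) :=
  Completion.continuous_map

variable {A : Type*} [NormedRing A] [StarRing A] [CStarRing A]

lemma completion_coe_star (a : A) : star (a : Completion A) = ((star a : A) : Completion A) :=
  Completion.map_coe star_isometry.uniformContinuous a

/-- The completion of a unital complex normed *-algebra whose norm satisfies the C*-identity is a
C*-algebra. -/
instance completionCStarAlgebra [NormedAlgebra ℂ A] [StarModule ℂ A] :
    CStarAlgebra (Completion A) where
  star_involutive x := by
    induction x using Completion.induction_on with
    | hp =>
      exact isClosed_eq (completion_continuous_star.comp completion_continuous_star) continuous_id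
    | ih a => simp only [completion_coe_star, star_star]
  star_mul x y := by
    induction x, y using Completion.induction_on₂ with
    | hp =>
      exact isClosed_eq (completion_continuous_star.comp (continuous_fst.mul continuous_snd))
        ((completion_continuous_star.comp continuous_snd).mul
          (completion_continuous_star.comp continuous_fst))
    | ih a b => simp only [completion_coe_star, ← Completion.coe_mul, star_mul]
  star_add x y := by
    induction x, y using Completion.induction_on₂ with
    | hp =>
      exact isClosed_eq (completion_continuous_star.comp (continuous_fst.add continuous_snd))
        ((completion_continuous_star.comp continuous_fst).add
          (completion_continuous_star.comp continuous_snd))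
    | ih a b => simp only [completion_coe_star, ← Completion.coe_add, star_add]
  norm_mul_self_le x := by
    induction x using Completion.induction_on with
    | hp =>
      exact isClosed_le (continuous_norm.mul continuous_norm)
        (continuous_norm.comp (completion_continuous_star.mul continuous_id))
    | ih a =>
      rw [completion_coe_star, ← Completion.coe_mul, Completion.norm_coe, Completion.norm_coe]
      exact CStarRing.norm_mul_self_le a
  norm_smul_le := norm_smul_le
  star_smul c x := by
    induction x using Completion.induction_on with
    | hp =>
      exact isClosed_eq (completion_continuous_star.comp (continuous_const_smul c))
        (completion_continuous_star.const_smul (star c))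
    | ih a => simp only [completion_coe_star, ← Completion.coe_smul, star_smul]

end CompletionStar

/-- The Weyl algebra `𝒲(E, ħσ)`: the completion of `Δ(E, ħσ)` in the minimal regular norm. -/
def WeylAlgebra {E : Type u} [AddCommGroup E] [Module ℝ E] (σ : SymplecticForm E) (ħ : ℝ) :
    Type u :=
  UniformSpace.Completion (WeylSpan σ ħ)

instance {E : Type u} [AddCommGroup E] [Module ℝ E] (σ : SymplecticForm E) (ħ : ℝ) :
    CStarAlgebra (WeylAlgebra σ ħ) :=
  inferInstanceAs (CStarAlgebra (UniformSpace.Completion (WeylSpan σ ħ)))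

/-- The Weyl element `W_ħ(F)` of the Weyl algebra. -/
def WeylAlgebra.weyl {E : Type u} [AddCommGroup E] [Module ℝ E] (σ : SymplecticForm E) (ħ : ℝ)
    (F : E) : WeylAlgebra σ ħ :=
  ((WeylSpan.weyl σ ħ F : WeylSpan σ ħ) : UniformSpace.Completion (WeylSpan σ ħ))

/-! ### The bidual of a C*-algebra, with its product and involution -/

section Bidual

variable (A : Type u) [CStarAlgebra A]

/-- The Banach space bidual `A**`. -/
abbrev Bidual : Type u := StrongDual ℂ (StrongDual ℂ A)

variable {A}

/-- The involution of the dual: `ω*(a) = conj (ω(a*))`. -/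
def dualStar : StrongDual ℂ A →L⋆[ℂ] StrongDual ℂ A :=
  LinearMap.mkContinuous
    { toFun := fun ω =>
        ((starL ℂ : ℂ ≃L⋆[ℂ] ℂ) : ℂ →L⋆[ℂ] ℂ).comp
          (ω.comp ((starL ℂ : A ≃L⋆[ℂ] A) : A →L⋆[ℂ] A))
      map_add' := fun ω ρ => by ext a; simp
      map_smul' := fun c ω => by ext a; simp } 1 fun ω => by
    rw [one_mul]
    refine ContinuousLinearMap.opNorm_le_bound _ (norm_nonneg ω) fun a => ?_
    simpa using ω.le_opNorm (star a)

lemma dualStar_apply (ω : StrongDual ℂ A) (a : A) : dualStar ω a = star (ω (star a)) := rfl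

/-- The involution of the bidual: `Φ*(ω) = conj (Φ(ω*))`. -/
def bidualStar (Φ : Bidual A) : Bidual A :=
  ((starL ℂ : ℂ ≃L⋆[ℂ] ℂ) : ℂ →L⋆[ℂ] ℂ).comp (Φ.comp dualStar)

lemma bidualStar_apply (Φ : Bidual A) (ω : StrongDual ℂ A) :
    bidualStar Φ ω = star (Φ (dualStar ω)) := rfl

/-- The functional `ω · a : b ↦ ω(ab)`, linear in `a` and in `ω`. -/
def dualMul : StrongDual ℂ A →L[ℂ] A →L[ℂ] StrongDual ℂ A :=
  ((ContinuousLinearMap.compL ℂ A (A →L[ℂ] A) (StrongDual ℂ A)).flip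
    (ContinuousLinearMap.mul ℂ A)).comp (ContinuousLinearMap.compL ℂ A A ℂ)

lemma dualMul_apply (ω : StrongDual ℂ A) (a b : A) : dualMul ω a b = ω (a * b) := rfl

/-- The functional `Ψ · ω : a ↦ Ψ(ω · a)`, linear in `ω`. -/
def bidualAct (Ψ : Bidual A) : StrongDual ℂ A →L[ℂ] StrongDual ℂ A :=
  (ContinuousLinearMap.compL ℂ A (StrongDual ℂ A) ℂ Ψ).comp dualMul

lemma bidualAct_apply (Ψ : Bidual A) (ω : StrongDual ℂ A) (a : A) :
    bidualAct Ψ ω a = Ψ (dualMul ω a) := rfl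

/-- The (Arens) product of the bidual, `(Φ Ψ)(ω) = Φ(Ψ · ω)`. It extends the product of `A`. -/
def bidualMul (Φ Ψ : Bidual A) : Bidual A := Φ.comp (bidualAct Ψ)

lemma bidualMul_apply (Φ Ψ : Bidual A) (ω : StrongDual ℂ A) :
    bidualMul Φ Ψ ω = Φ (bidualAct Ψ ω) := rfl

/-- For `V ⊆ A*`, the annihilator in `A**` of the weak* closure of (the canonical image of) `V`
in `A***`, the latter being the dual of `A**`. -/
def annihilatorOfClosure (V : Set (StrongDual ℂ A)) : Submodule ℂ (Bidual A) where
  carrier := {Φ | ∀ ξ ∈ closure ((fun ω : StrongDual ℂ A =>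
    StrongDual.toWeakDual (NormedSpace.inclusionInDoubleDual ℂ (StrongDual ℂ A) ω)) '' V), ξ Φ = 0}
  add_mem' := fun {Φ Ψ} hΦ hΨ ξ hξ => by rw [map_add, hΦ ξ hξ, hΨ ξ hξ, add_zero]
  zero_mem' := fun ξ _ => map_zero ξ
  smul_mem' := fun c Φ hΦ ξ hξ => by rw [map_smul, hΦ ξ hξ, smul_zero]

end Bidual

/-! ### Regular functionals and the algebra `𝔄_ħ` -/

section Regular

variable {E : Type u} [AddCommGroup E] [Module ℝ E] (σ : SymplecticForm E) (ħ : ℝ)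

/-- A regular state of the Weyl algebra: a state `ω` such that `t ↦ ω(W_ħ(tF))` is continuous for
every `F`. -/
structure IsRegularState (ω : StrongDual ℂ (WeylAlgebra σ ħ)) : Prop where
  isState : IsState (ω : WeylAlgebra σ ħ →ₗ[ℂ] ℂ)
  continuous_weyl : ∀ F : E, Continuous fun t : ℝ => ω (WeylAlgebra.weyl σ ħ (t • F))

/-- The space `V_ħ` of regular functionals: the complex linear span of the regular states. -/
def regularFunctionals : Submodule ℂ (StrongDual ℂ (WeylAlgebra σ ħ)) :=
  Submodule.span ℂ {ω | IsRegularState σ ħ ω}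

/-- The annihilator `N(V̄_ħ)` in the bidual of the Weyl algebra. -/
def regularAnnihilator : Submodule ℂ (Bidual (WeylAlgebra σ ħ)) :=
  annihilatorOfClosure (regularFunctionals σ ħ : Set (StrongDual ℂ (WeylAlgebra σ ħ)))

/-- The Banach space `V_ħ`, with the norm of `𝒲(E, ħσ)*`, as a type. -/
def RegularFunctional : Type u := regularFunctionals σ ħ

instance : NormedAddCommGroup (RegularFunctional σ ħ) :=
  inferInstanceAs (NormedAddCommGroup (regularFunctionals σ ħ))

instance : NormedSpace ℂ (RegularFunctional σ ħ) :=
  inferInstanceAs (NormedSpace ℂ (regularFunctionals σ ħ))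

/-- The inclusion of `V_ħ` in the dual of the Weyl algebra. -/
def RegularFunctional.val (ω : RegularFunctional σ ħ) : StrongDual ℂ (WeylAlgebra σ ħ) :=
  Subtype.val (show regularFunctionals σ ħ from ω)

/-- The set underlying `𝔄_ħ = 𝒲(E, ħσ)** / N(V̄_ħ)`. -/
def RegularQuotient : Type u :=
  Quotient (@Submodule.quotientRel ℂ (Bidual (WeylAlgebra σ ħ)) inferInstance inferInstance
    inferInstance (regularAnnihilator σ ħ))

/-- The quotient map `𝒲(E, ħσ)** → 𝔄_ħ`. -/
def RegularQuotient.mk (Φ : Bidual (WeylAlgebra σ ħ)) : RegularQuotient σ ħ :=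
  Quotient.mk _ Φ

lemma RegularQuotient.mk_surjective : Function.Surjective (RegularQuotient.mk σ ħ) :=
  Quotient.mk_surjective

lemma RegularQuotient.mk_eq_mk_iff (Φ Ψ : Bidual (WeylAlgebra σ ħ)) :
    RegularQuotient.mk σ ħ Φ = RegularQuotient.mk σ ħ Ψ ↔ Φ - Ψ ∈ regularAnnihilator σ ħ :=
  Quotient.eq.trans (@Submodule.quotientRel_def ℂ (Bidual (WeylAlgebra σ ħ)) inferInstance
    inferInstance inferInstance (regularAnnihilator σ ħ) Φ Ψ)

/-- The C*-algebra structure `inst` on `𝔄_ħ` is the one induced from the bidual: the vector space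
operations, product and involution are those of representatives, and the norm is the quotient
norm. (As `mk` is surjective, there is at most one such structure.) -/
structure IsInducedStructure (inst : CStarAlgebra (RegularQuotient σ ħ)) : Prop where
  mk_add : ∀ Φ Ψ, RegularQuotient.mk σ ħ (Φ + Ψ) =
    RegularQuotient.mk σ ħ Φ + RegularQuotient.mk σ ħ Ψ
  mk_smul : ∀ (c : ℂ) Φ, RegularQuotient.mk σ ħ (c • Φ) = c • RegularQuotient.mk σ ħ Φ
  mk_mul : ∀ Φ Ψ, RegularQuotient.mk σ ħ (bidualMul Φ Ψ) =
    RegularQuotient.mk σ ħ Φ * RegularQuotient.mk σ ħ Ψ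
  mk_star : ∀ Φ, RegularQuotient.mk σ ħ (bidualStar Φ) = star (RegularQuotient.mk σ ħ Φ)
  norm_mk : ∀ Φ, ‖RegularQuotient.mk σ ħ Φ‖ =
    Metric.infDist Φ (regularAnnihilator σ ħ : Set (Bidual (WeylAlgebra σ ħ)))

end Regular

end

/-! A functional on the bidual vanishes on the weak* closure of `V_ħ` exactly when it is annihilated
by `V_ħ` itself (`mem_annihilatorOfClosure_iff`), so restriction to `V_ħ` identifies `𝔄_ħ` with the
dual of `V_ħ`, and by Hahn–Banach the quotient norm is the dual norm (`norm_comp_eq_infDist`). What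
remains is to see that this dual is a C*-algebra and that `V_ħ` is complete.

Both rest on describing `V_ħ` as the span of all coefficients `⟪ξ, π(·) η⟫` of the GNS
representations of the regular states (`coefficientSpace_eq_regularFunctionals`). Here regularity of
the cyclic vector spreads to every vector: the Weyl relations carry it to the vectors `π(W(G)) Ω`,
and density does the rest (`continuousVectors_eq_top`).

Each representation extends to the bidual, turning the Arens product into composition
(`bidualRep_mul`). A Kaplansky density argument shows that, on the span of the coefficients, the
norm of `Φ` is controlled by the norms of the operators `bidualRep (π i) Φ`
(`norm_apply_le_of_norm_bidualRep_le`). Hence the dual of `V_ħ` embeds isometrically and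
multiplicatively in a family of operator algebras, and the C*-axioms are inherited
(`dualCStarAlgebra`).

The same norm control, combined with Hahn–Banach separation, shows that every element of the unit
ball of `V_ħ` is a norm limit of combinations `p₀ + i p₁ - p₂ - i p₃` of positive regular
functionals of norm at most one (`mem_closure_quadComb`). Since the cone of positive regular
functionals is norm closed, summing successive approximations shows that `V_ħ` is closed
(`isClosed_coefficientSpace`). -/

noncomputable section

open scoped InnerProductSpace

/-! ### Coefficient functionals and the extension of a representation to the bidual. -/

section VectorFunctional

variable {A : Type u} [CStarAlgebra A]
  {K : Type*} [NormedAddCommGroup K] [InnerProductSpace ℂ K] [CompleteSpace K]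
  (π : A →⋆ₐ[ℂ] (K →L[ℂ] K))

lemma norm_rep_le (a : A) : ‖π a‖ ≤ ‖a‖ := NonUnitalStarAlgHom.norm_apply_le π a

lemma inner_rep_star (a : A) (ξ η : K) : ⟪ξ, π (star a) η⟫_ℂ = ⟪π a ξ, η⟫_ℂ := by
  rw [map_star, ContinuousLinearMap.star_eq_adjoint, ContinuousLinearMap.adjoint_inner_right]

/-- The coefficient functional `a ↦ ⟪ξ, π(a) η⟫` of a representation. -/
def vecFun (ξ η : K) : StrongDual ℂ A :=
  LinearMap.mkContinuous
    { toFun := fun a => ⟪ξ, π a η⟫_ℂ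
      map_add' := fun a b => by simp
      map_smul' := fun c a => by simp } (‖ξ‖ * ‖η‖) fun a => by
    refine (norm_inner_le_norm _ _).trans ?_
    have h1 := (π a).le_opNorm η
    have h2 := mul_le_mul_of_nonneg_right (norm_rep_le π a) (norm_nonneg η)
    have h3 := mul_le_mul_of_nonneg_left (h1.trans h2) (norm_nonneg ξ)
    exact h3.trans (le_of_eq (by ring))

lemma vecFun_apply (ξ η : K) (a : A) : vecFun π ξ η a = ⟪ξ, π a η⟫_ℂ := rfl

lemma norm_vecFun_le (ξ η : K) : ‖vecFun π ξ η‖ ≤ ‖ξ‖ * ‖η‖ :=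
  LinearMap.mkContinuous_norm_le _ (by positivity) _

lemma vecFun_add_left (ξ ξ' η : K) : vecFun π (ξ + ξ') η = vecFun π ξ η + vecFun π ξ' η := by
  ext a; simp [vecFun_apply]

lemma vecFun_add_right (ξ η η' : K) : vecFun π ξ (η + η') = vecFun π ξ η + vecFun π ξ η' := by
  ext a; simp [vecFun_apply]

lemma vecFun_smul_left (c : ℂ) (ξ η : K) : vecFun π (c • ξ) η = star c • vecFun π ξ η := by
  ext a; simp [vecFun_apply, mul_comm]

lemma vecFun_smul_right (c : ℂ) (ξ η : K) : vecFun π ξ (c • η) = c • vecFun π ξ η := by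
  ext a; simp [vecFun_apply]

lemma dualStar_vecFun (ξ η : K) : dualStar (vecFun π ξ η) = vecFun π η ξ := by
  ext a
  rw [dualStar_apply, vecFun_apply, vecFun_apply, inner_rep_star, ← inner_conj_symm η]
  rfl

lemma dualMul_vecFun (ξ η : K) (a : A) :
    dualMul (vecFun π ξ η) a = vecFun π (π (star a) ξ) η := by
  ext b
  rw [dualMul_apply, vecFun_apply, vecFun_apply, ← inner_rep_star, star_star, map_mul]
  rfl

/-- The sesquilinear form `(ξ, η) ↦ Φ(⟪ξ, π(·) η⟫)` of an element of the bidual. -/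
def bidualForm (Φ : Bidual A) : K →L⋆[ℂ] K →L[ℂ] ℂ :=
  LinearMap.mkContinuous₂
    (LinearMap.mk₂'ₛₗ (starRingEnd ℂ) (RingHom.id ℂ) (fun ξ η => Φ (vecFun π ξ η))
      (fun ξ ξ' η => by rw [vecFun_add_left, map_add])
      (fun c ξ η => by rw [vecFun_smul_left, map_smul]; rfl)
      (fun ξ η η' => by rw [vecFun_add_right, map_add])
      (fun c ξ η => by rw [vecFun_smul_right, map_smul]; rfl)) ‖Φ‖ fun ξ η => by
    refine (Φ.le_opNorm _).trans ?_
    rw [mul_assoc]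
    exact mul_le_mul_of_nonneg_left (norm_vecFun_le π ξ η) (norm_nonneg _)

/-- The canonical extension of a representation to the bidual. -/
def bidualRep (Φ : Bidual A) : K →L[ℂ] K :=
  ContinuousLinearMap.adjoint (InnerProductSpace.continuousLinearMapOfBilin (bidualForm π Φ))

lemma inner_bidualRep (Φ : Bidual A) (ξ η : K) :
    ⟪ξ, bidualRep π Φ η⟫_ℂ = Φ (vecFun π ξ η) := by
  rw [bidualRep, ContinuousLinearMap.adjoint_inner_right,
    InnerProductSpace.continuousLinearMapOfBilin_apply]
  rfl

lemma bidualRep_ext {Φ : Bidual A} {T : K →L[ℂ] K}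
    (h : ∀ ξ η, Φ (vecFun π ξ η) = ⟪ξ, T η⟫_ℂ) : bidualRep π Φ = T := by
  ext η
  exact ext_inner_left ℂ fun ξ => by rw [inner_bidualRep, h]

lemma bidualRep_add (Φ Ψ : Bidual A) :
    bidualRep π (Φ + Ψ) = bidualRep π Φ + bidualRep π Ψ :=
  bidualRep_ext π fun ξ η => by
    simp [inner_bidualRep]

lemma bidualRep_smul (c : ℂ) (Φ : Bidual A) : bidualRep π (c • Φ) = c • bidualRep π Φ :=
  bidualRep_ext π fun ξ η => by
    simp [inner_bidualRep]

lemma bidualRep_sub (Φ Ψ : Bidual A) :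
    bidualRep π (Φ - Ψ) = bidualRep π Φ - bidualRep π Ψ :=
  bidualRep_ext π fun ξ η => by
    simp [inner_bidualRep]

lemma bidualRep_zero : bidualRep π (0 : Bidual A) = 0 :=
  bidualRep_ext π fun ξ η => by simp

lemma bidualRep_inclusion (a : A) :
    bidualRep π (NormedSpace.inclusionInDoubleDual ℂ A a) = π a :=
  bidualRep_ext π fun ξ η => by rw [NormedSpace.dual_def, vecFun_apply]

/-- The bidual action keeps coefficients of `π` among coefficients of `π`, moving the operator onto
the right-hand vector. This is why the Arens product becomes composition. -/
lemma bidualAct_vecFun (Ψ : Bidual A) (ξ η : K) :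
    bidualAct Ψ (vecFun π ξ η) = vecFun π ξ (bidualRep π Ψ η) := by
  ext a
  rw [bidualAct_apply, dualMul_vecFun, ← inner_bidualRep, vecFun_apply, ← inner_rep_star,
    star_star]

lemma bidualRep_mul (Φ Ψ : Bidual A) :
    bidualRep π (bidualMul Φ Ψ) = bidualRep π Φ * bidualRep π Ψ :=
  bidualRep_ext π fun ξ η => by
    rw [bidualMul_apply, bidualAct_vecFun, ← inner_bidualRep]
    rfl

lemma bidualRep_star (Φ : Bidual A) : bidualRep π (bidualStar Φ) = star (bidualRep π Φ) :=
  bidualRep_ext π fun ξ η => by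
    rw [bidualStar_apply, dualStar_vecFun, ← inner_bidualRep,
      ContinuousLinearMap.star_eq_adjoint, ContinuousLinearMap.adjoint_inner_right,
      ← inner_conj_symm (bidualRep π Φ ξ)]
    rfl

lemma norm_bidualRep_le {Φ : Bidual A} {C : ℝ} (hC : 0 ≤ C)
    (h : ∀ ξ η, ‖Φ (vecFun π ξ η)‖ ≤ C * (‖ξ‖ * ‖η‖)) : ‖bidualRep π Φ‖ ≤ C := by
  refine ContinuousLinearMap.opNorm_le_bound _ hC fun η => ?_
  -- Testing against `ξ = bidualRep π Φ η` gives `‖Tη‖² ≤ C ‖Tη‖ ‖η‖` for `T = bidualRep π Φ`.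
  have h1 := h (bidualRep π Φ η) η
  rw [← inner_bidualRep, inner_self_eq_norm_sq_to_K, norm_pow, RCLike.norm_ofReal,
    abs_norm] at h1
  by_cases h0 : ‖bidualRep π Φ η‖ = 0
  · rw [h0]; positivity
  · have h2 : 0 < ‖bidualRep π Φ η‖ := lt_of_le_of_ne (norm_nonneg _) (Ne.symm h0)
    nlinarith

end VectorFunctional

/-! ### Real functionals on complex Hilbert spaces. -/

section RealFunctionals

variable {K : Type*} [NormedAddCommGroup K] [InnerProductSpace ℂ K] [CompleteSpace K]

/-- A real functional is the real part of a complex one, to which Riesz representation applies. The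
real form is needed because `evalPair`, which involves adjoints, is only real-linear. -/
lemma exists_re_inner_eq (g : StrongDual ℝ K) : ∃ ζ : K, ∀ v, g v = (⟪ζ, v⟫_ℂ).re := by
  refine ⟨(InnerProductSpace.toDual ℂ K).symm (StrongDual.extendRCLike (𝕜 := ℂ) g), fun v => ?_⟩
  rw [InnerProductSpace.toDual_symm_apply]
  exact (StrongDual.re_extendRCLike_apply (𝕜 := ℂ) g v).symm

lemma exists_re_inner_pair_eq (g : StrongDual ℝ (K × K)) :
    ∃ ζ ζ' : K, ∀ v, g v = (⟪ζ, v.1⟫_ℂ).re + (⟪ζ', v.2⟫_ℂ).re := by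
  obtain ⟨ζ, h⟩ := exists_re_inner_eq (g.comp (ContinuousLinearMap.inl ℝ K K))
  obtain ⟨ζ', h'⟩ := exists_re_inner_eq (g.comp (ContinuousLinearMap.inr ℝ K K))
  refine ⟨ζ, ζ', fun v => ?_⟩
  rw [← h, ← h']
  simp [← map_add]

end RealFunctionals

/-- If the real part of a functional is at most `u` on the ball of radius `R`, its norm is at
most `u / R`. -/
lemma mul_norm_le_of_re_le {𝔼 : Type*} [NormedAddCommGroup 𝔼] [NormedSpace ℂ 𝔼]
    (ω : StrongDual ℂ 𝔼) {R u : ℝ} (hR : 0 ≤ R) (h : ∀ a, ‖a‖ ≤ R → (ω a).re ≤ u) :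
    R * ‖ω‖ ≤ u := by
  have hu : 0 ≤ u := by simpa using h 0 (by simpa using hR)
  have h1 : ‖(R : ℂ) • ω‖ ≤ u := by
    refine ContinuousLinearMap.opNorm_le_bound _ hu fun a => ?_
    rcases eq_or_ne a 0 with rfl | ha
    · simp
    have ha' : 0 < ‖a‖ := norm_pos_iff.2 ha
    obtain ⟨c, hc, hca⟩ := RCLike.exists_norm_eq_mul_self (ω a)
    have h2 := h (((R / ‖a‖ : ℝ) : ℂ) • c • a) (by
      rw [norm_smul, norm_smul, hc, Complex.norm_real, Real.norm_of_nonneg (by positivity), one_mul,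
        div_mul_cancel₀ _ ha'.ne'])
    have h3 : ω (((R / ‖a‖ : ℝ) : ℂ) • c • a) = ((R / ‖a‖ * ‖ω a‖ : ℝ) : ℂ) := by
      rw [map_smul, map_smul, smul_eq_mul, smul_eq_mul, ← hca, Complex.ofReal_mul]
      rfl
    rw [h3, Complex.ofReal_re, div_mul_eq_mul_div, div_le_iff₀ ha'] at h2
    simpa [abs_of_nonneg hR] using h2
  rwa [norm_smul, Complex.norm_real, Real.norm_of_nonneg hR] at h1

/-! ### *-Strong approximation of bidual elements by bounded nets of the algebra. -/

section Approximation

variable {A : Type u} [CStarAlgebra A] {ι : Type*} {K : ι → Type*}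
  [∀ i, NormedAddCommGroup (K i)] [∀ i, InnerProductSpace ℂ (K i)] [∀ i, CompleteSpace (K i)]
  (π : ∀ i, A →⋆ₐ[ℂ] (K i →L[ℂ] K i))

open Filter Topology

/-- Real-linear evaluation of `π(a)` and `π(a)*` at finitely or infinitely many vectors. -/
def evalPair {J : Type*} (x : J → Σ i, K i) : A →ₗ[ℝ] (∀ j, K (x j).1 × K (x j).1) where
  toFun a j := (π _ a (x j).2, π _ (star a) (x j).2)
  map_add' a b := by ext j <;> simp
  map_smul' c a := by
    ext j <;> simp only [← Complex.coe_smul, star_smul, Complex.star_def, Complex.conj_ofReal,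
      map_smul] <;> rfl

/-- The image of the ball is convex, so a point outside its closure could be strictly separated from
it. The separating functional pulls back to the real part of a sum `ω` of coefficients, and
separation would give `Re Φ(ω) > ‖Φ‖ ‖ω‖`. -/
lemma bidualRep_mem_closure_finite {J : Type*} [Finite J] (x : J → Σ i, K i) (Φ : Bidual A) :
    (fun j => (bidualRep (π _) Φ (x j).2, star (bidualRep (π _) Φ) (x j).2)) ∈
      closure (evalPair π x '' Metric.closedBall 0 ‖Φ‖) := by
  classical
  have := Fintype.ofFinite J
  by_contra hy
  obtain ⟨f, u, hf, hu⟩ := geometric_hahn_banach_closed_point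
    ((convex_closedBall (0 : A) ‖Φ‖).linear_image (evalPair π x)).closure isClosed_closure hy
  have hg := fun j => exists_re_inner_pair_eq
    (f.comp (ContinuousLinearMap.single ℝ (fun j => K (x j).1 × K (x j).1) j))
  choose ζ ζ' hg using hg
  have hsum : ∀ z : (∀ j, K (x j).1 × K (x j).1),
      f z = ∑ j, ((⟪ζ j, (z j).1⟫_ℂ).re + (⟪ζ' j, (z j).2⟫_ℂ).re) := by
    intro z
    conv_lhs => rw [← Finset.univ_sum_single z, map_sum]
    exact Finset.sum_congr rfl fun j _ => hg j (z j)
  -- The adjoint component contributes the coefficient with its two vectors interchanged: the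
  -- complex conjugation this costs is invisible to real parts.
  set ω : StrongDual ℂ A := ∑ j, (vecFun (π _) (ζ j) (x j).2 + vecFun (π _) (x j).2 (ζ' j)) with hω
  have h1 : ∀ a, f (evalPair π x a) = (ω a).re := by
    intro a
    rw [hsum, hω, sum_apply, Complex.re_sum]
    refine Finset.sum_congr rfl fun j _ => ?_
    rw [add_apply, Complex.add_re, vecFun_apply, vecFun_apply]
    congr 1
    change (⟪ζ' j, π _ (star a) (x j).2⟫_ℂ).re = _
    rw [inner_rep_star, ← inner_conj_symm, Complex.conj_re]
  have h2 : f (fun j => (bidualRep (π _) Φ (x j).2, star (bidualRep (π _) Φ) (x j).2)) =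
      (Φ ω).re := by
    rw [hsum, hω, map_sum, Complex.re_sum]
    refine Finset.sum_congr rfl fun j _ => ?_
    rw [map_add, Complex.add_re, ← inner_bidualRep, ← inner_bidualRep]
    congr 1
    rw [ContinuousLinearMap.star_eq_adjoint, ContinuousLinearMap.adjoint_inner_right,
      ← inner_conj_symm, Complex.conj_re]
  have h3 : ‖Φ‖ * ‖ω‖ ≤ u := mul_norm_le_of_re_le ω (norm_nonneg Φ) fun a ha => by
    rw [← h1]
    exact (hf _ (subset_closure ⟨a, by simpa using ha, rfl⟩)).le
  rw [h2] at hu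
  have h4 := (Complex.re_le_norm _).trans (Φ.le_opNorm ω)
  linarith

/-- A basic neighbourhood in the product topology constrains only finitely many vectors. -/
lemma bidualRep_mem_closure (Φ : Bidual A) :
    (fun x : Σ i, K i => (bidualRep (π _) Φ x.2, star (bidualRep (π _) Φ) x.2)) ∈
      closure (evalPair π id '' Metric.closedBall 0 ‖Φ‖) := by
  rw [mem_closure_iff]
  intro o ho hy
  obtain ⟨I, v, hv, hvo⟩ := isOpen_pi_iff.1 ho _ hy
  have h := bidualRep_mem_closure_finite π (fun j : I => (j : Σ i, K i)) Φ
  rw [mem_closure_iff] at h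
  obtain ⟨z, hz, a, ha, rfl⟩ := h (Set.pi Set.univ fun j : I => v j)
    (isOpen_set_pi Set.finite_univ fun j _ => (hv j j.2).1) fun j _ => (hv j j.2).2
  exact ⟨_, hvo fun j hj => hz ⟨j, hj⟩ trivial, a, ha, rfl⟩

/-- An element of the bidual is approximated *-strongly by a bounded net of the algebra. -/
lemma exists_filter_tendsto (Φ : Bidual A) : ∃ l : Filter A, l.NeBot ∧ (∀ᶠ a in l, ‖a‖ ≤ ‖Φ‖) ∧
    ∀ i (ξ : K i), Tendsto (fun a => π i a ξ) l (𝓝 (bidualRep (π i) Φ ξ)) ∧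
      Tendsto (fun a => π i (star a) ξ) l (𝓝 (star (bidualRep (π i) Φ) ξ)) := by
  have h := bidualRep_mem_closure π Φ
  rw [mem_closure_iff_clusterPt, ClusterPt, ← map_principal, ← neBot_inf_comap_iff_map'] at h
  -- The net is the neighbourhood filter of the limit point, pulled back along `evalPair` and
  -- restricted to the ball.
  refine ⟨_, h, ?_, fun i ξ => ?_⟩
  · refine Eventually.filter_mono inf_le_right ?_
    simp
  · have h1 : Tendsto (evalPair π id) (comap (evalPair π id) (𝓝 (fun x : Σ i, K i =>
      (bidualRep (π _) Φ x.2, star (bidualRep (π _) Φ) x.2))) ⊓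
        𝓟 (Metric.closedBall 0 ‖Φ‖)) _ := tendsto_comap.mono_left inf_le_left
    have h2 := (tendsto_pi_nhds.1 h1) ⟨i, ξ⟩
    exact ⟨(continuous_fst.tendsto _).comp h2, (continuous_snd.tendsto _).comp h2⟩

end Approximation

/-! ### A continuous retraction onto the unit ball of a C*-algebra. -/

section Cutoff

/-- The function `t ↦ max(1, t)^{-1/2}`. -/
def cutoff (t : ℝ) : ℝ := (√(max 1 t))⁻¹

lemma continuous_cutoff : Continuous cutoff := by
  refine Continuous.inv₀ (by fun_prop) fun t => ?_
  exact (Real.sqrt_pos.2 (lt_of_lt_of_le one_pos (le_max_left 1 t))).ne'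

lemma cutoff_of_le_one {t : ℝ} (h : t ≤ 1) : cutoff t = 1 := by simp [cutoff, h]

lemma cutoff_mul_mul_cutoff_le {t : ℝ} : cutoff t * t * cutoff t ≤ 1 := by
  have h : 0 < max 1 t := lt_of_lt_of_le one_pos (le_max_left 1 t)
  have h1 : cutoff t * t * cutoff t = t / max 1 t := by
    rw [cutoff, mul_right_comm, ← mul_inv, Real.mul_self_sqrt h.le, inv_mul_eq_div]
  rw [h1, div_le_one h]
  exact le_max_right _ _

variable {B : Type*} [CStarAlgebra B]

lemma spectrum_star_mul_self_subset (b : B) {R : ℝ} (hb : ‖b‖ ≤ R) :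
    spectrum ℝ (star b * b) ⊆ Set.Icc 0 (R ^ 2) := by
  intro t ht
  refine ⟨spectrum_star_mul_self_nonneg t ht, ?_⟩
  rcases subsingleton_or_nontrivial B with hB | hB
  · rw [spectrum.of_subsingleton] at ht
    exact ht.elim
  refine (Real.le_norm_self t).trans ((spectrum.norm_le_norm_of_mem ht).trans ?_)
  rw [CStarRing.norm_star_mul_self, sq]
  exact mul_self_le_mul_self (norm_nonneg _) hb

/-- The contraction `b · max(1, b* b)^{-1/2}`. -/
def contraction (b : B) : B := b * cfc cutoff (star b * b)

/-- With `c = contraction b`, the element `c* c` is the function `t / max(1, t) ≤ 1` applied to `b*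
b`. -/
lemma norm_contraction_le (b : B) : ‖contraction b‖ ≤ 1 := by
  have hc := continuous_cutoff
  have h0 : IsSelfAdjoint (star b * b) := IsSelfAdjoint.star_mul_self b
  have h1 : star (contraction b) * contraction b =
      cfc (fun t => cutoff t * t * cutoff t) (star b * b) := by
    rw [cfc_mul _ _ _ (by fun_prop) (by fun_prop), cfc_mul _ _ _ (by fun_prop) (by fun_prop),
      cfc_id' ℝ (star b * b), contraction, star_mul, ← cfc_star]
    simp [mul_assoc]
  have h2 : ‖star (contraction b) * contraction b‖ ≤ 1 := by
    rw [h1]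
    refine norm_cfc_le zero_le_one fun t ht => ?_
    have ht0 := (spectrum_star_mul_self_subset b le_rfl ht).1
    rw [Real.norm_of_nonneg (mul_nonneg (mul_nonneg (by unfold cutoff; positivity) ht0)
      (by unfold cutoff; positivity))]
    exact cutoff_mul_mul_cutoff_le
  rw [CStarRing.norm_star_mul_self] at h2
  nlinarith [norm_nonneg (contraction b)]

/-- The cutoff equals one on the spectrum of `b* b`. Consequently cutting off a net does not disturb
a limit that already lies in the unit ball. -/
lemma contraction_eq_self {b : B} (hb : ‖b‖ ≤ 1) : contraction b = b := by
  have h0 : IsSelfAdjoint (star b * b) := IsSelfAdjoint.star_mul_self b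
  have h : cfc cutoff (star b * b) = 1 := by
    rw [← cfc_const_one ℝ (star b * b)]
    refine cfc_congr fun t ht => ?_
    exact cutoff_of_le_one (by simpa using (spectrum_star_mul_self_subset b hb ht).2)
  rw [contraction, h, mul_one]

-- The interval `[0, R²]` contains the spectrum of `b* b` for every `b` in the ball of radius `R`,
-- so a single polynomial approximates the cutoff uniformly along a bounded net.
open Polynomial in
lemma norm_contraction_sub_le (b : B) {R ε : ℝ} (hb : ‖b‖ ≤ R) (hε : 0 ≤ ε) {p : ℝ[X]}
    (hp : ∀ t ∈ Set.Icc 0 (R ^ 2), |p.eval t - cutoff t| ≤ ε) :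
    ‖contraction b - b * aeval (star b * b) p‖ ≤ R * ε := by
  have hc := continuous_cutoff
  have h0 : IsSelfAdjoint (star b * b) := IsSelfAdjoint.star_mul_self b
  rw [contraction, ← mul_sub]
  refine (norm_mul_le _ _).trans (mul_le_mul hb ?_ (norm_nonneg _) ((norm_nonneg _).trans hb))
  rw [← cfc_polynomial p (star b * b), ← cfc_sub _ _ _ (by fun_prop) (by fun_prop)]
  refine norm_cfc_le hε fun t ht => ?_
  rw [Real.norm_eq_abs, abs_sub_comm]
  exact hp t (spectrum_star_mul_self_subset b hb ht)

end Cutoff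

/-! ### Strong limits of products, polynomials and cutoffs. -/

section StrongLimits

open Filter Topology

variable {α : Type*} {l : Filter α}
  {K : Type*} [NormedAddCommGroup K] [InnerProductSpace ℂ K]

lemma tendsto_mul_apply {S S' : α → K →L[ℂ] K} {T T' : K →L[ℂ] K} {R : ℝ}
    (hR : ∀ᶠ a in l, ‖S a‖ ≤ R) (h : ∀ ξ, Tendsto (fun a => S a ξ) l (𝓝 (T ξ)))
    (h' : ∀ ξ, Tendsto (fun a => S' a ξ) l (𝓝 (T' ξ))) (ξ : K) :
    Tendsto (fun a => (S a * S' a) ξ) l (𝓝 ((T * T') ξ)) := by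
  have h1 : Tendsto (fun a => S a (S' a ξ - T' ξ)) l (𝓝 0) := by
    refine squeeze_zero_norm' (a := fun a => R * ‖S' a ξ - T' ξ‖) ?_ ?_
    · filter_upwards [hR] with a ha
      exact ((S a).le_opNorm _).trans (mul_le_mul_of_nonneg_right ha (norm_nonneg _))
    · simpa using (tendsto_iff_norm_sub_tendsto_zero.1 (h' ξ)).const_mul R
  have h2 := h1.add (h (T' ξ))
  simpa using h2

open Polynomial in
lemma tendsto_aeval_apply {S : α → K →L[ℂ] K} {T : K →L[ℂ] K} {R : ℝ}
    (hR : ∀ᶠ a in l, ‖S a‖ ≤ R) (h : ∀ ξ, Tendsto (fun a => S a ξ) l (𝓝 (T ξ)))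
    (p : ℝ[X]) (ξ : K) :
    Tendsto (fun a => aeval (S a) p ξ) l (𝓝 (aeval T p ξ)) := by
  induction p using Polynomial.induction_on' generalizing ξ with
  | add p q hp hq => simpa using (hp ξ).add (hq ξ)
  | monomial n c =>
    have hpow : ∀ ξ, Tendsto (fun a => (S a ^ n) ξ) l (𝓝 ((T ^ n) ξ)) := by
      clear ξ
      induction n with
      | zero => intro ξ; simpa using tendsto_const_nhds
      | succ n ih =>
        simp only [pow_succ']
        exact tendsto_mul_apply hR h ih
    simp only [aeval_monomial, ← Algebra.smul_def]
    exact (hpow ξ).const_smul c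

variable [CompleteSpace K]

/-- *-Strong convergence of a bounded net is preserved by `S ↦ S max(1, S* S)^{-1/2}`. -/
lemma tendsto_contraction_apply {S : α → K →L[ℂ] K} {T : K →L[ℂ] K} {R : ℝ}
    (hR : ∀ᶠ a in l, ‖S a‖ ≤ R) (hT : ‖T‖ ≤ R) (h : ∀ ξ, Tendsto (fun a => S a ξ) l (𝓝 (T ξ)))
    (h' : ∀ ξ, Tendsto (fun a => star (S a) ξ) l (𝓝 (star T ξ))) (ξ : K) :
    Tendsto (fun a => contraction (S a) ξ) l (𝓝 (contraction T ξ)) := by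
  have hR0 : 0 ≤ R := (norm_nonneg _).trans hT
  rw [Metric.tendsto_nhds]
  intro ε hε
  -- `R * δ` bounds the operator-norm error of replacing the cutoff by a polynomial within `δ` of
  -- it, both along the net and at the limit.
  obtain ⟨δ, hδ, hδε⟩ : ∃ δ > 0, R * δ * ‖ξ‖ < ε / 3 := by
    refine ⟨ε / 3 / (R * ‖ξ‖ + 1), by positivity, ?_⟩
    rw [mul_right_comm, ← mul_div_assoc, div_lt_iff₀ (by positivity)]
    nlinarith [mul_nonneg hR0 (norm_nonneg ξ)]
  obtain ⟨p, hp⟩ := exists_polynomial_near_of_continuousOn 0 (R ^ 2) cutoff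
    continuous_cutoff.continuousOn δ hδ
  -- Convergence of the adjoints is used here: it makes `star (S a) * S a` converge strongly.
  have hlim : Tendsto (fun a => (S a * Polynomial.aeval (star (S a) * S a) p) ξ) l
      (𝓝 ((T * Polynomial.aeval (star T * T) p) ξ)) := by
    refine tendsto_mul_apply hR h (tendsto_aeval_apply (R := R * R) ?_ ?_ p) ξ
    · filter_upwards [hR] with a ha
      rw [CStarRing.norm_star_mul_self]
      exact mul_self_le_mul_self (norm_nonneg _) ha
    · refine tendsto_mul_apply (R := R) ?_ h' h
      filter_upwards [hR] with a ha
      rwa [norm_star]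
  have hclose : ∀ U : K →L[ℂ] K, ‖U‖ ≤ R →
      dist (contraction U ξ) ((U * Polynomial.aeval (star U * U) p) ξ) < ε / 3 := by
    intro U hU
    rw [dist_eq_norm, ← sub_apply]
    refine lt_of_le_of_lt ((ContinuousLinearMap.le_opNorm _ _).trans
      (mul_le_mul_of_nonneg_right ?_ (norm_nonneg ξ))) hδε
    exact norm_contraction_sub_le U hU hδ.le fun t ht => (hp t ht).le
  filter_upwards [hR, Metric.tendsto_nhds.1 hlim (ε / 3) (by positivity)] with a ha hla
  have h1 := hclose _ ha
  have h2 := hclose _ hT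
  rw [dist_comm] at h2
  have h3 := dist_triangle4 (contraction (S a) ξ) ((S a * Polynomial.aeval (star (S a) * S a) p) ξ)
    ((T * Polynomial.aeval (star T * T) p) ξ) (contraction T ξ)
  linarith

end StrongLimits

/-! ### Kaplansky density and the resulting norm estimate. -/

section Density

open Filter Topology

variable {A : Type u} [CStarAlgebra A] {ι : Type*} {K : ι → Type*}
  [∀ i, NormedAddCommGroup (K i)] [∀ i, InnerProductSpace ℂ (K i)] [∀ i, CompleteSpace (K i)]
  (π : ∀ i, A →⋆ₐ[ℂ] (K i →L[ℂ] K i))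

/-- Star homomorphisms commute with the continuous functional calculus. The cutoff can thus be made
once in `A`, simultaneously for all representations. -/
lemma rep_contraction {K : Type*} [NormedAddCommGroup K] [InnerProductSpace ℂ K] [CompleteSpace K]
    (π : A →⋆ₐ[ℂ] (K →L[ℂ] K)) (a : A) : π (contraction a) = contraction (π a) := by
  have hc := continuous_cutoff
  have hπ : Continuous π := AddMonoidHomClass.continuous_of_bound π 1 fun a => by
    simpa using norm_rep_le π a
  have h := StarAlgHomClass.map_cfc (S := ℂ) π cutoff (star a * a) (by fun_prop) hπ
    (IsSelfAdjoint.star_mul_self a) (by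
      rw [map_mul, map_star]; exact IsSelfAdjoint.star_mul_self _)
  rw [contraction, map_mul, h, map_mul, map_star, contraction]

/-- The span of the coefficient functionals of a family of representations. -/
def coefficientSpace : Submodule ℂ (StrongDual ℂ A) :=
  Submodule.span ℂ {ω | ∃ i, ∃ ξ η : K i, ω = vecFun (π i) ξ η}

lemma vecFun_mem_coefficientSpace (i : ι) (ξ η : K i) :
    vecFun (π i) ξ η ∈ coefficientSpace π := Submodule.subset_span ⟨i, ξ, η, rfl⟩

/-- A form of Kaplansky's density theorem. -/
lemma exists_filter_tendsto_unitBall {Φ : Bidual A} (hΦ : ∀ i, ‖bidualRep (π i) Φ‖ ≤ 1) :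
    ∃ l : Filter A, l.NeBot ∧ (∀ᶠ a in l, ‖a‖ ≤ 1) ∧
      ∀ ω ∈ coefficientSpace π, Tendsto (fun a => ω a) l (𝓝 (Φ ω)) := by
  obtain ⟨l, hl, hb, h⟩ := exists_filter_tendsto π Φ
  -- Cutting off the approximants puts them in the unit ball; in each representation their limit
  -- `bidualRep (π i) Φ` is already a contraction, so it is unchanged.
  refine ⟨l.map contraction, hl.map _, ?_, fun ω hω => ?_⟩
  · rw [eventually_map]
    exact Eventually.of_forall norm_contraction_le
  rw [tendsto_map'_iff]
  induction hω using Submodule.span_induction with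
  | zero => simpa using! tendsto_const_nhds
  | add ω ρ _ _ hω hρ => simpa using! hω.add hρ
  | smul c ω _ hω => simpa using! hω.const_mul c
  | mem ω hω =>
    obtain ⟨i, ξ, η, rfl⟩ := hω
    have h1 : Tendsto (fun a => contraction (π i a) η) l
        (𝓝 (contraction (bidualRep (π i) Φ) η)) := by
      refine tendsto_contraction_apply (R := max ‖Φ‖ 1) ?_ ((hΦ i).trans (le_max_right _ _))
        (fun ξ => (h i ξ).1) (fun ξ => ?_) η
      · filter_upwards [hb] with a ha
        exact (norm_rep_le (π i) a).trans (ha.trans (le_max_left _ _))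
      · simpa only [map_star] using (h i ξ).2
    rw [contraction_eq_self (hΦ i)] at h1
    rw [← inner_bidualRep]
    refine (tendsto_const_nhds.inner h1).congr fun a => ?_
    rw [Function.comp_apply, vecFun_apply, rep_contraction]

/-- After rescaling, Kaplansky density makes `Φ ω` a limit of values `ω a` with `‖a‖ ≤ 1`. This is
the estimate behind both the C*-norm on the dual and the closedness of the coefficient space. -/
lemma norm_apply_le_of_norm_bidualRep_le {Φ : Bidual A} {C : ℝ}
    (hΦ : ∀ i, ‖bidualRep (π i) Φ‖ ≤ C) (hC : 0 ≤ C) {ω : StrongDual ℂ A}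
    (hω : ω ∈ coefficientSpace π) : ‖Φ ω‖ ≤ C * ‖ω‖ := by
  -- Dividing by some `D > C` and letting `D` tend to `C` also covers `C = 0`.
  have key : ∀ D : ℝ, C < D → ‖Φ ω‖ ≤ D * ‖ω‖ := by
    intro D hD
    have hD0 : 0 < D := hC.trans_lt hD
    have h1 : ∀ i, ‖bidualRep (π i) (((D⁻¹ : ℝ) : ℂ) • Φ)‖ ≤ 1 := fun i => by
      rw [bidualRep_smul, norm_smul, Complex.norm_real, Real.norm_of_nonneg (by positivity),
        inv_mul_le_one₀ hD0]
      exact (hΦ i).trans hD.le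
    obtain ⟨l, hl, hb, h⟩ := exists_filter_tendsto_unitBall π h1
    have h2 : ‖(((D⁻¹ : ℝ) : ℂ) • Φ) ω‖ ≤ ‖ω‖ := by
      refine le_of_tendsto (h ω hω).norm ?_
      filter_upwards [hb] with a ha
      exact (ω.le_opNorm a).trans (mul_le_of_le_one_right (norm_nonneg _) ha)
    rwa [smul_apply, norm_smul, Complex.norm_real,
      Real.norm_of_nonneg (by positivity), inv_mul_le_iff₀ hD0] at h2
  have h3 : Tendsto (fun D : ℝ => D * ‖ω‖) (𝓝[>] C) (𝓝 (C * ‖ω‖)) :=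
    ((continuous_id.mul continuous_const).tendsto C).mono_left nhdsWithin_le_nhds
  exact ge_of_tendsto h3 (eventually_nhdsWithin_of_forall fun D hD => key D hD)

end Density

/-! ### Hahn–Banach extension and transport of structure. -/

section Extension

variable {X 𝔼 : Type*} [NormedAddCommGroup X] [NormedSpace ℂ X]
  [NormedAddCommGroup 𝔼] [NormedSpace ℂ 𝔼] (v : X →ₗᵢ[ℂ] 𝔼)

lemma exists_extension_of_linearIsometry (f : StrongDual ℂ X) :
    ∃ g : StrongDual ℂ 𝔼, (∀ x, g (v x) = f x) ∧ ‖g‖ = ‖f‖ := by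
  obtain ⟨g, hg, hn⟩ := exists_extension_norm_eq (LinearMap.range v.toLinearMap)
    (f.comp (v.equivRange.symm : _ →L[ℂ] X))
  have hgv : ∀ x, g (v x) = f x := fun x => by
    have := hg (v.equivRange x)
    simpa using this
  refine ⟨g, hgv, le_antisymm ?_ ?_⟩
  · rw [hn]
    refine ContinuousLinearMap.opNorm_le_bound _ (norm_nonneg _) fun y => ?_
    simpa using f.le_opNorm (v.equivRange.symm y)
  · refine ContinuousLinearMap.opNorm_le_bound _ (norm_nonneg _) fun x => ?_
    rw [← hgv, ← v.norm_map x]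
    exact g.le_opNorm _

end Extension

section CStarTransport

/-- Transport of a C*-algebra structure along a bijection. -/
abbrev CStarAlgebra.ofEquiv {Q M : Type*} [CStarAlgebra M] (e : Q ≃ M) : CStarAlgebra Q :=
  letI ring : Ring Q := e.ring
  letI normedRing : NormedRing Q := NormedRing.induced Q M e.ringEquiv e.injective
  letI algebra : Algebra ℂ Q := e.algebra ℂ
  letI normedAlgebra : NormedAlgebra ℂ Q :=
    NormedAlgebra.induced ℂ Q M (e.algEquiv ℂ)
  letI starRing : StarRing Q := e.starRing
  { normedRing, starRing, normedAlgebra with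
    toCompleteSpace := by
      have h : Isometry e := AddMonoidHomClass.isometry_of_norm e.ringEquiv fun _ => rfl
      exact (IsometryEquiv.mk e h).completeSpace
    norm_mul_self_le := fun q => by
      change ‖e q‖ * ‖e q‖ ≤ ‖e (e.symm (e (e.symm (star (e q))) * e q))‖
      rw [e.apply_symm_apply, e.apply_symm_apply]
      exact CStarRing.norm_mul_self_le (e q)
    star_smul := fun c q => by
      change e.symm (star (e (e.symm (c • e q)))) = e.symm (star c • e (e.symm (star (e q))))
      rw [e.apply_symm_apply, e.apply_symm_apply, star_smul] }

end CStarTransport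

/-! ### The dual of a coefficient space as a C*-algebra. -/

section DualAlgebra

variable {A : Type u} [CStarAlgebra A] {ι : Type*} {K : ι → Type*}
  [∀ i, NormedAddCommGroup (K i)] [∀ i, InnerProductSpace ℂ (K i)] [∀ i, CompleteSpace (K i)]
  {π : ∀ i, A →⋆ₐ[ℂ] (K i →L[ℂ] K i)}
  {X : Type*} [NormedAddCommGroup X] [NormedSpace ℂ X] {v : X →ₗᵢ[ℂ] StrongDual ℂ A}

/-- The restriction of functionals on the dual of `A` to a subspace `v : X → A*`. -/
def restrictFunctional (v : X →ₗᵢ[ℂ] StrongDual ℂ A) (Φ : Bidual A) : StrongDual ℂ X :=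
  Φ.comp v.toContinuousLinearMap

lemma restrictFunctional_apply (Φ : Bidual A) (x : X) : restrictFunctional v Φ x = Φ (v x) := rfl

/-- A norm-preserving extension of a functional on the subspace `v : X → A*`. -/
def extendFunctional (v : X →ₗᵢ[ℂ] StrongDual ℂ A) (f : StrongDual ℂ X) : Bidual A :=
  (exists_extension_of_linearIsometry v f).choose

lemma extendFunctional_apply (f : StrongDual ℂ X) (x : X) : extendFunctional v f (v x) = f x :=
  (exists_extension_of_linearIsometry v f).choose_spec.1 x

lemma norm_extendFunctional (f : StrongDual ℂ X) : ‖extendFunctional v f‖ = ‖f‖ :=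
  (exists_extension_of_linearIsometry v f).choose_spec.2

lemma restrictFunctional_extendFunctional (f : StrongDual ℂ X) :
    restrictFunctional v (extendFunctional v f) = f := by
  ext x
  rw [restrictFunctional_apply, extendFunctional_apply]

/-- The operator by which a functional on `X ⊆ A*` acts in a representation whose coefficients
belong to `X`. -/
def dualRep (π : ∀ i, A →⋆ₐ[ℂ] (K i →L[ℂ] K i)) (v : X →ₗᵢ[ℂ] StrongDual ℂ A) (i : ι)
    (f : StrongDual ℂ X) : K i →L[ℂ] K i :=
  bidualRep (π i) (extendFunctional v f)

/-- All coefficients lie in `X`, so the operators of a bidual element depend only on its restriction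
to `X`, not on the chosen extension. -/
lemma dualRep_restrictFunctional (h : ∀ ω, ω ∈ coefficientSpace π ↔ ∃ x, v x = ω) (i : ι)
    (Φ : Bidual A) : dualRep π v i (restrictFunctional v Φ) = bidualRep (π i) Φ :=
  bidualRep_ext _ fun ξ η => by
    obtain ⟨x, hx⟩ := (h _).1 (vecFun_mem_coefficientSpace π i ξ η)
    rw [inner_bidualRep, ← hx, extendFunctional_apply, restrictFunctional_apply]

lemma norm_dualRep_le (i : ι) (f : StrongDual ℂ X) : ‖dualRep π v i f‖ ≤ ‖f‖ := by
  refine norm_bidualRep_le _ (norm_nonneg _) fun ξ η => ?_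
  rw [← norm_extendFunctional (v := v)]
  exact (ContinuousLinearMap.le_opNorm _ _).trans
    (mul_le_mul_of_nonneg_left (norm_vecFun_le _ ξ η) (norm_nonneg _))

lemma norm_le_of_norm_dualRep_le (h : ∀ ω, ω ∈ coefficientSpace π ↔ ∃ x, v x = ω)
    {f : StrongDual ℂ X} {C : ℝ} (hC : 0 ≤ C) (hf : ∀ i, ‖dualRep π v i f‖ ≤ C) : ‖f‖ ≤ C :=
  ContinuousLinearMap.opNorm_le_bound _ hC fun x => by
    rw [← extendFunctional_apply (v := v), ← v.norm_map x]
    exact norm_apply_le_of_norm_bidualRep_le π hf hC ((h _).2 ⟨x, rfl⟩)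

/-- The extensions `extendFunctional v f` are chosen with no linearity in `f`. Passing to another
extension, such as a sum of chosen ones, makes `dualRep` linear. -/
lemma dualRep_eq (h : ∀ ω, ω ∈ coefficientSpace π ↔ ∃ x, v x = ω) (i : ι)
    {f : StrongDual ℂ X} {Φ : Bidual A} (hf : ∀ x, Φ (v x) = f x) :
    dualRep π v i f = bidualRep (π i) Φ := by
  rw [← dualRep_restrictFunctional h]
  exact congrArg _ (ContinuousLinearMap.ext fun x => (hf x).symm)

lemma dualRep_add (h : ∀ ω, ω ∈ coefficientSpace π ↔ ∃ x, v x = ω) (i : ι)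
    (f g : StrongDual ℂ X) : dualRep π v i (f + g) = dualRep π v i f + dualRep π v i g :=
  (dualRep_eq h i fun x => by
    rw [add_apply, extendFunctional_apply, extendFunctional_apply, add_apply]).trans
    (bidualRep_add (π i) (extendFunctional v f) (extendFunctional v g))

lemma dualRep_sub (h : ∀ ω, ω ∈ coefficientSpace π ↔ ∃ x, v x = ω) (i : ι)
    (f g : StrongDual ℂ X) : dualRep π v i (f - g) = dualRep π v i f - dualRep π v i g :=
  (dualRep_eq h i fun x => by
    rw [sub_apply, extendFunctional_apply, extendFunctional_apply, sub_apply]).trans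
    (bidualRep_sub (π i) (extendFunctional v f) (extendFunctional v g))

lemma dualRep_smul (h : ∀ ω, ω ∈ coefficientSpace π ↔ ∃ x, v x = ω) (i : ι) (c : ℂ)
    (f : StrongDual ℂ X) : dualRep π v i (c • f) = c • dualRep π v i f :=
  (dualRep_eq h i fun x => by
    rw [smul_apply, extendFunctional_apply, smul_apply]).trans
    (bidualRep_smul (π i) c (extendFunctional v f))

lemma dualRep_zero (h : ∀ ω, ω ∈ coefficientSpace π ↔ ∃ x, v x = ω) (i : ι) :
    dualRep π v i (0 : StrongDual ℂ X) = 0 :=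
  (dualRep_eq h i fun _ => rfl).trans (bidualRep_zero (π i))

/-- The representations are jointly faithful on the dual, by the norm estimate with bound zero;
algebraic identities may therefore be checked on operators. -/
lemma dualRep_ext (h : ∀ ω, ω ∈ coefficientSpace π ↔ ∃ x, v x = ω) {f g : StrongDual ℂ X}
    (hfg : ∀ i, dualRep π v i f = dualRep π v i g) : f = g := by
  rw [← sub_eq_zero, ← norm_le_zero_iff]
  refine norm_le_of_norm_dualRep_le h le_rfl fun i => ?_
  rw [dualRep_sub h, hfg, sub_self, norm_zero]

/-- The product of the dual of `X ⊆ A*` induced by the Arens product. -/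
def dualProduct (v : X →ₗᵢ[ℂ] StrongDual ℂ A) (f g : StrongDual ℂ X) : StrongDual ℂ X :=
  restrictFunctional v (bidualMul (extendFunctional v f) (extendFunctional v g))

/-- The unit of the dual of `X ⊆ A*`. -/
def dualOne (v : X →ₗᵢ[ℂ] StrongDual ℂ A) : StrongDual ℂ X :=
  restrictFunctional v (NormedSpace.inclusionInDoubleDual ℂ A 1)

/-- The involution of the dual of `X ⊆ A*`. -/
def dualInvolution (v : X →ₗᵢ[ℂ] StrongDual ℂ A) (f : StrongDual ℂ X) : StrongDual ℂ X :=
  restrictFunctional v (bidualStar (extendFunctional v f))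

lemma dualRep_product (h : ∀ ω, ω ∈ coefficientSpace π ↔ ∃ x, v x = ω) (i : ι)
    (f g : StrongDual ℂ X) :
    dualRep π v i (dualProduct v f g) = dualRep π v i f * dualRep π v i g := by
  rw [dualProduct, dualRep_restrictFunctional h, bidualRep_mul]
  rfl

lemma dualRep_one (h : ∀ ω, ω ∈ coefficientSpace π ↔ ∃ x, v x = ω) (i : ι) :
    dualRep π v i (dualOne v) = 1 := by
  rw [dualOne, dualRep_restrictFunctional h, bidualRep_inclusion, map_one]

lemma dualRep_involution (h : ∀ ω, ω ∈ coefficientSpace π ↔ ∃ x, v x = ω) (i : ι)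
    (f : StrongDual ℂ X) : dualRep π v i (dualInvolution v f) = star (dualRep π v i f) := by
  rw [dualInvolution, dualRep_restrictFunctional h, bidualRep_star]
  rfl

/-- The dual of the coefficient space of a family of representations of a C*-algebra is a
C*-algebra. -/
abbrev dualCStarAlgebra (h : ∀ ω, ω ∈ coefficientSpace π ↔ ∃ x, v x = ω) :
    CStarAlgebra (StrongDual ℂ X) :=
  letI ring : Ring (StrongDual ℂ X) :=
    { (inferInstance : AddCommGroup (StrongDual ℂ X)) with
      mul := dualProduct v
      one := dualOne v
      mul_assoc := fun a b c => dualRep_ext h fun i => by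
        change dualRep π v i (dualProduct v (dualProduct v a b) c) =
          dualRep π v i (dualProduct v a (dualProduct v b c))
        simp only [dualRep_product h, mul_assoc]
      one_mul := fun a => dualRep_ext h fun i => by
        change dualRep π v i (dualProduct v (dualOne v) a) = _
        rw [dualRep_product h, dualRep_one h, one_mul]
      mul_one := fun a => dualRep_ext h fun i => by
        change dualRep π v i (dualProduct v a (dualOne v)) = _
        rw [dualRep_product h, dualRep_one h, mul_one]
      left_distrib := fun a b c => dualRep_ext h fun i => by
        change dualRep π v i (dualProduct v a (b + c)) =
          dualRep π v i (dualProduct v a b + dualProduct v a c)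
        simp only [dualRep_product h, dualRep_add h, mul_add]
      right_distrib := fun a b c => dualRep_ext h fun i => by
        change dualRep π v i (dualProduct v (a + b) c) =
          dualRep π v i (dualProduct v a c + dualProduct v b c)
        simp only [dualRep_product h, dualRep_add h, add_mul]
      zero_mul := fun a => dualRep_ext h fun i => by
        change dualRep π v i (dualProduct v 0 a) = _
        rw [dualRep_product h, dualRep_zero h, zero_mul]
      mul_zero := fun a => dualRep_ext h fun i => by
        change dualRep π v i (dualProduct v a 0) = _
        rw [dualRep_product h, dualRep_zero h, mul_zero] }
  letI normedRing : NormedRing (StrongDual ℂ X) :=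
    { ring, (inferInstance : NormedAddCommGroup (StrongDual ℂ X)) with
      norm_mul_le := fun f g => norm_le_of_norm_dualRep_le h (by positivity) fun i => by
        change ‖dualRep π v i (dualProduct v f g)‖ ≤ _
        rw [dualRep_product h]
        exact (norm_mul_le _ _).trans (mul_le_mul (norm_dualRep_le i f)
          (norm_dualRep_le i g) (norm_nonneg _) (norm_nonneg _)) }
  letI algebra : Algebra ℂ (StrongDual ℂ X) :=
    Algebra.ofModule
      (fun c f g => dualRep_ext h fun i => by
        change dualRep π v i (dualProduct v (c • f) g) = dualRep π v i (c • dualProduct v f g)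
        simp only [dualRep_product h, dualRep_smul h, smul_mul_assoc])
      (fun c f g => dualRep_ext h fun i => by
        change dualRep π v i (dualProduct v f (c • g)) = dualRep π v i (c • dualProduct v f g)
        simp only [dualRep_product h, dualRep_smul h, mul_smul_comm])
  letI normedAlgebra : NormedAlgebra ℂ (StrongDual ℂ X) :=
    { algebra with norm_smul_le := fun c f => norm_smul_le c f }
  letI starRing : StarRing (StrongDual ℂ X) :=
    { star := dualInvolution v
      star_involutive := fun f => dualRep_ext h fun i => by
        rw [dualRep_involution h, dualRep_involution h, star_star]
      star_mul := fun f g => dualRep_ext h fun i => by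
        change dualRep π v i (dualInvolution v (dualProduct v f g)) =
          dualRep π v i (dualProduct v (dualInvolution v g) (dualInvolution v f))
        simp only [dualRep_product h, dualRep_involution h, star_mul]
      star_add := fun f g => dualRep_ext h fun i => by
        change dualRep π v i (dualInvolution v (f + g)) =
          dualRep π v i (dualInvolution v f + dualInvolution v g)
        simp only [dualRep_add h, dualRep_involution h, star_add] }
  { normedRing, starRing, normedAlgebra with
    toCompleteSpace := inferInstance
    norm_mul_self_le := fun f => by
      -- In each representation the square of the norm of the operator of `f` is the norm of the
      -- operator of `f* f`, which is at most `‖f* f‖`.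
      have h1 : ‖f‖ ≤ √‖dualProduct v (dualInvolution v f) f‖ :=
        norm_le_of_norm_dualRep_le h (Real.sqrt_nonneg _) fun i => by
          refine Real.le_sqrt_of_sq_le ?_
          rw [sq, ← CStarRing.norm_star_mul_self, ← dualRep_involution h, ← dualRep_product h]
          exact norm_dualRep_le i _
      have h3 := mul_le_mul h1 h1 (norm_nonneg f) (Real.sqrt_nonneg _)
      rwa [Real.mul_self_sqrt (norm_nonneg _)] at h3
    star_smul := fun c f => dualRep_ext h fun i => by
      change dualRep π v i (dualInvolution v (c • f)) =
        dualRep π v i (star c • dualInvolution v f)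
      simp only [dualRep_smul h, dualRep_involution h, star_smul] }

end DualAlgebra

/-! ### A closedness criterion for spans of closed cones. -/

section Closedness

open Filter Topology

variable {D : Type*} [NormedAddCommGroup D] [NormedSpace ℂ D]

/-- The combination `p₀ + i p₁ - p₂ - i p₃`. -/
def quadComb (p : Fin 4 → D) : D := ∑ k : Fin 4, Complex.I ^ (k : ℕ) • p k

lemma quadComb_add (p q : Fin 4 → D) :
    quadComb (fun k => p k + q k) = quadComb p + quadComb q := by
  simp only [quadComb, smul_add, Finset.sum_add_distrib]

lemma quadComb_smul (c : ℂ) (p : Fin 4 → D) : quadComb (fun k => c • p k) = c • quadComb p := by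
  simp only [quadComb, Finset.smul_sum]
  exact Finset.sum_congr rfl fun k _ => smul_comm _ _ _

lemma quadComb_mem (V : Submodule ℂ D) {p : Fin 4 → D} (hp : ∀ k, p k ∈ V) : quadComb p ∈ V :=
  V.sum_mem fun k _ => V.smul_mem _ (hp k)

/-- A subspace whose elements are approximated, with control of the norms, by combinations of
elements of a closed convex cone contained in the subspace is closed. -/
lemma isClosed_of_quadComb_approx [CompleteSpace D] (V : Submodule ℂ D) {P : Set D}
    (hP : IsClosed P) (hP0 : 0 ∈ P) (hPadd : ∀ p ∈ P, ∀ q ∈ P, p + q ∈ P) (hPV : P ⊆ V)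
    (happ : ∀ x ∈ V, ∀ ε > 0, ∃ p : Fin 4 → D,
      (∀ k, p k ∈ P ∧ ‖p k‖ ≤ ‖x‖) ∧ ‖x - quadComb p‖ < ε) :
    IsClosed (V : Set D) := by
  have step : ∀ (x : V.topologicalClosure) (n : ℕ), ∃ p : Fin 4 → D,
      (∀ k, p k ∈ P ∧ ‖p k‖ ≤ ‖(x : D)‖ + (1 / 2) ^ n) ∧ ‖(x : D) - quadComb p‖ < (1 / 2) ^ n := by
    intro x n
    have hε : (0 : ℝ) < (1 / 2) ^ n / 2 := by positivity
    obtain ⟨y, hy, hxy⟩ := Metric.mem_closure_iff.1 x.2 _ hε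
    obtain ⟨p, hp, hpy⟩ := happ y hy _ hε
    rw [dist_eq_norm] at hxy
    refine ⟨p, fun k => ⟨(hp k).1, (hp k).2.trans ?_⟩, ?_⟩
    · have := norm_sub_norm_le y (x : D)
      rw [norm_sub_rev] at this
      linarith
    · have := norm_add_le ((x : D) - y) (y - quadComb p)
      rw [sub_add_sub_cancel] at this
      linarith
  choose p hp hpx using step
  -- Successive approximation: `s n` is the remainder of `x` after `n` combinations have been
  -- subtracted.
  let next : ℕ → V.topologicalClosure → V.topologicalClosure := fun n x =>
    ⟨(x : D) - quadComb (p x n), V.topologicalClosure.sub_mem x.2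
      (V.le_topologicalClosure (quadComb_mem V fun k => hPV (hp x n k).1))⟩
  refine closure_subset_iff_isClosed.1 fun x hx => ?_
  let s : ℕ → V.topologicalClosure := fun n =>
    Nat.rec (motive := fun _ => V.topologicalClosure) ⟨x, hx⟩ next n
  have hs : ∀ n : ℕ, (s (n + 1) : D) = (s n : D) - quadComb (p (s n) n) := fun n => rfl
  -- The remainder at `n + 1` is below `(1/2)^n = 2 * (1/2)^(n+1)`, whence the `2`; the term `‖x‖`
  -- serves `n = 0`.
  have hsn : ∀ n, ‖(s n : D)‖ ≤ (‖x‖ + 2) * (1 / 2) ^ n := by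
    rintro (_ | n)
    · change ‖x‖ ≤ _
      simp
    · rw [hs]
      refine (hpx _ _).le.trans ?_
      rw [pow_succ]
      nlinarith [norm_nonneg x, pow_pos (one_half_pos (α := ℝ)) n]
  have hgeo : Summable fun n : ℕ => (‖x‖ + 3) * (1 / 2 : ℝ) ^ n :=
    (summable_geometric_of_lt_one (by norm_num) (by norm_num)).mul_left _
  have hsum : ∀ k, Summable fun n => p (s n) n k := fun k =>
    Summable.of_norm_bounded hgeo fun n => ((hp (s n) n k).2).trans (by
      have := hsn n
      linarith)
  have hlim : Tendsto (fun n => (s n : D)) atTop (𝓝 0) := by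
    refine squeeze_zero_norm hsn ?_
    simpa using (tendsto_pow_atTop_nhds_zero_of_lt_one (by norm_num : (0 : ℝ) ≤ 1 / 2)
      (by norm_num)).const_mul (‖x‖ + 2)
  have htele : ∀ n, ∑ m ∈ Finset.range n, quadComb (p (s m) m) = x - s n := by
    intro n
    induction n with
    | zero => rw [Finset.sum_range_zero]; exact (sub_self x).symm
    | succ n ih => rw [Finset.sum_range_succ, ih, hs]; abel
  have h1 : Tendsto (fun n => ∑ m ∈ Finset.range n, quadComb (p (s m) m)) atTop (𝓝 x) := by
    simp only [htele]
    simpa using hlim.const_sub x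
  have h2 : HasSum (fun m => quadComb (p (s m) m)) (quadComb fun k => ∑' m, p (s m) m k) :=
    hasSum_sum fun k _ => (hsum k).hasSum.const_smul _
  rw [tendsto_nhds_unique h1 h2.tendsto_sum_nat]
  -- Each of the four series sums to an element of the closed cone `P`, hence of `V`; this is how a
  -- limit of elements of `V` is brought back into `V`.
  refine quadComb_mem V fun k => hPV ?_
  refine hP.mem_of_tendsto (hsum k).hasSum.tendsto_sum_nat (Eventually.of_forall fun n => ?_)
  induction n with
  | zero => simpa using hP0
  | succ n ih =>
    rw [Finset.sum_range_succ]
    exact hPadd _ ih _ (hp _ _ k).1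

end Closedness

/-! ### Decomposition into positive functionals and closedness of the coefficient space. -/

section CoefficientSpace

variable {A : Type u} [CStarAlgebra A] {ι : Type*} {K : ι → Type*}
  [∀ i, NormedAddCommGroup (K i)] [∀ i, InnerProductSpace ℂ (K i)] [∀ i, CompleteSpace (K i)]
  (π : ∀ i, A →⋆ₐ[ℂ] (K i →L[ℂ] K i))

/-- Polarisation, for a form conjugate-linear in its first variable. -/
lemma vecFun_eq_quadComb {K : Type*} [NormedAddCommGroup K] [InnerProductSpace ℂ K]
    [CompleteSpace K] (π : A →⋆ₐ[ℂ] (K →L[ℂ] K)) (ξ η : K) :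
    vecFun π ξ η = quadComb fun k : Fin 4 => ((1 / 4 : ℝ) : ℂ) •
      vecFun π (Complex.I ^ (k : ℕ) • ξ + η) (Complex.I ^ (k : ℕ) • ξ + η) := by
  have hI3 : Complex.I ^ 3 = -Complex.I := by rw [pow_succ, Complex.I_sq]; ring
  have hs : star Complex.I = -Complex.I := Complex.conj_I
  ext a
  simp only [quadComb, Fin.sum_univ_four, vecFun_add_left, vecFun_add_right, vecFun_smul_left,
    vecFun_smul_right, smul_add, smul_smul, add_apply, smul_apply, smul_eq_mul, Fin.val_zero,
    Fin.val_one, Fin.val_two, pow_zero, pow_one, Complex.I_sq,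
    show ((3 : Fin 4) : ℕ) = 3 from rfl, hI3, star_one, star_neg, hs]
  push_cast
  ring_nf
  simp only [Complex.I_sq]
  ring

variable {P : Set (StrongDual ℂ A)}

/-- Otherwise some `Φ` has `Re Φ ≤ u` on the convex set of combinations and `Re Φ(ω) > u`. By
polarisation this set contains all coefficients of vectors in the unit balls, so all operators of
`Φ` have norm at most `u`, and the Kaplansky estimate forces `|Φ(ω)| ≤ u`. -/
lemma mem_closure_quadComb (hPadd : ∀ p ∈ P, ∀ q ∈ P, p + q ∈ P)
    (hPsmul : ∀ p ∈ P, ∀ c : ℝ, 0 ≤ c → (c : ℂ) • p ∈ P) (hP : ∀ i ξ, vecFun (π i) ξ ξ ∈ P)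
    (hP0 : 0 ∈ P) {ω : StrongDual ℂ A} (hω : ω ∈ coefficientSpace π) (hn : ‖ω‖ ≤ 1) :
    ω ∈ closure {ρ | ∃ p : Fin 4 → StrongDual ℂ A,
      (∀ k, p k ∈ P ∧ ‖p k‖ ≤ 1) ∧ ρ = quadComb p} := by
  set S : Set (StrongDual ℂ A) := {ρ | ∃ p : Fin 4 → StrongDual ℂ A,
    (∀ k, p k ∈ P ∧ ‖p k‖ ≤ 1) ∧ ρ = quadComb p}
  have hconv : Convex ℝ S := by
    rintro _ ⟨p, hp, rfl⟩ _ ⟨q, hq, rfl⟩ a b ha hb hab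
    refine ⟨fun k => (a : ℂ) • p k + (b : ℂ) • q k, fun k => ⟨hPadd _ (hPsmul _ (hp k).1 a ha) _
      (hPsmul _ (hq k).1 b hb), ?_⟩, ?_⟩
    · refine (norm_add_le _ _).trans ?_
      rw [norm_smul, norm_smul, Complex.norm_real, Complex.norm_real, Real.norm_of_nonneg ha,
        Real.norm_of_nonneg hb]
      nlinarith [(hp k).2, (hq k).2]
    · rw [quadComb_add, quadComb_smul, quadComb_smul]
      rfl
  by_contra hcl
  obtain ⟨Φ, u, hΦ, hu⟩ := RCLike.geometric_hahn_banach_closed_point (𝕜 := ℂ) hconv.closure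
    isClosed_closure hcl
  have hS' : ∀ ρ ∈ S, (Φ ρ).re ≤ u := fun ρ hρ => (hΦ ρ (subset_closure hρ)).le
  have hu0 : 0 ≤ u := by
    simpa using hS' 0 ⟨fun _ => 0, fun _ => ⟨hP0, by simp⟩, by simp [quadComb]⟩
  have hvec : ∀ i (ξ η : K i), ‖ξ‖ ≤ 1 → ‖η‖ ≤ 1 → vecFun (π i) ξ η ∈ S := by
    intro i ξ η hξ hη
    refine ⟨_, fun k => ⟨hPsmul _ (hP i _) _ (by norm_num), ?_⟩, vecFun_eq_quadComb (π i) ξ η⟩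
    -- The bound `2 * 2` on the functional is cancelled exactly by the factor `1 / 4` of
    -- polarisation.
    have h1 : ‖Complex.I ^ (k : ℕ) • ξ + η‖ ≤ 2 := by
      refine (norm_add_le _ _).trans ?_
      rw [norm_smul, norm_pow, Complex.norm_I, one_pow, one_mul]
      linarith
    rw [norm_smul, Complex.norm_real]
    have h2 := norm_vecFun_le (π i) (Complex.I ^ (k : ℕ) • ξ + η) (Complex.I ^ (k : ℕ) • ξ + η)
    have h3 := mul_le_mul h1 h1 (norm_nonneg _) zero_le_two
    rw [Real.norm_of_nonneg (by norm_num)]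
    linarith
  have hrep : ∀ i, ‖bidualRep (π i) Φ‖ ≤ u := by
    refine fun i => norm_bidualRep_le _ hu0 fun ξ η => ?_
    rcases eq_or_ne ξ 0 with rfl | hξ
    · rw [← inner_bidualRep]; simp
    rcases eq_or_ne η 0 with rfl | hη
    · rw [← inner_bidualRep]; simp
    have hξ' := norm_pos_iff.2 hξ
    have hη' := norm_pos_iff.2 hη
    obtain ⟨c, hc, hca⟩ := RCLike.exists_norm_eq_mul_self (Φ (vecFun (π i) ξ η))
    -- The phase `c` turns the value of `Φ` into its modulus, so a bound on real parts suffices.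
    have h1 := hS' _ (hvec i (((‖ξ‖⁻¹ : ℝ) : ℂ) • ξ) ((((‖η‖⁻¹ : ℝ) : ℂ) * c) • η) (by
      rw [norm_smul, Complex.norm_real, norm_inv, norm_norm, inv_mul_cancel₀ hξ'.ne']) (by
      rw [norm_smul, norm_mul, hc, Complex.norm_real, norm_inv, norm_norm, mul_one,
        inv_mul_cancel₀ hη'.ne']))
    rw [vecFun_smul_left, vecFun_smul_right, map_smul, map_smul, smul_eq_mul, smul_eq_mul,
      mul_assoc, ← hca, Complex.star_def, Complex.conj_ofReal] at h1
    change (((‖ξ‖⁻¹ : ℝ) : ℂ) * (((‖η‖⁻¹ : ℝ) : ℂ) * ((‖Φ (vecFun (π i) ξ η)‖ : ℝ) : ℂ))).re ≤ u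
      at h1
    rw [← Complex.ofReal_mul, ← Complex.ofReal_mul, Complex.ofReal_re, inv_mul_le_iff₀ hξ',
      inv_mul_le_iff₀ hη'] at h1
    linarith
  have h1 := norm_apply_le_of_norm_bidualRep_le π hrep hu0 hω
  have h2 : (Φ ω).re ≤ ‖Φ ω‖ := Complex.re_le_norm _
  have h3 : u < (Φ ω).re := hu
  nlinarith

lemma isClosed_coefficientSpace (hPc : IsClosed P) (hPadd : ∀ p ∈ P, ∀ q ∈ P, p + q ∈ P)
    (hPsmul : ∀ p ∈ P, ∀ c : ℝ, 0 ≤ c → (c : ℂ) • p ∈ P) (hP : ∀ i ξ, vecFun (π i) ξ ξ ∈ P)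
    (hP0 : 0 ∈ P) (hPV : P ⊆ coefficientSpace π) :
    IsClosed (coefficientSpace π : Set (StrongDual ℂ A)) := by
  refine isClosed_of_quadComb_approx _ hPc hP0 hPadd hPV fun ω hω ε hε => ?_
  rcases eq_or_ne ω 0 with rfl | h0
  · exact ⟨fun _ => 0, fun _ => ⟨hP0, by simp⟩, by simpa [quadComb] using hε⟩
  have hn := norm_pos_iff.2 h0
  have h1 := mem_closure_quadComb π hPadd hPsmul hP hP0
    ((coefficientSpace π).smul_mem ((‖ω‖⁻¹ : ℝ) : ℂ) hω) (by
      rw [norm_smul, Complex.norm_real, norm_inv, norm_norm, inv_mul_cancel₀ hn.ne'])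
  obtain ⟨_, ⟨p, hp, rfl⟩, hlt⟩ := Metric.mem_closure_iff.1 h1 (ε / ‖ω‖) (by positivity)
  refine ⟨fun k => (‖ω‖ : ℂ) • p k, fun k => ⟨hPsmul _ (hp k).1 _ hn.le, ?_⟩, ?_⟩
  · rw [norm_smul, Complex.norm_real, norm_norm]
    exact mul_le_of_le_one_right hn.le (hp k).2
  · have h2 : ω - quadComb (fun k => (‖ω‖ : ℂ) • p k) =
        (‖ω‖ : ℂ) • (((‖ω‖⁻¹ : ℝ) : ℂ) • ω - quadComb p) := by
      rw [quadComb_smul, smul_sub, smul_smul, ← Complex.ofReal_mul, mul_inv_cancel₀ hn.ne',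
        Complex.ofReal_one, one_smul]
    rw [h2, norm_smul, Complex.norm_real, norm_norm, ← dist_eq_norm, mul_comm]
    exact (lt_div_iff₀ hn).1 hlt

end CoefficientSpace

/-! ### The GNS construction and positive functionals. -/

section GNS

open UniformSpace

variable {A : Type u} [CStarAlgebra A]

/-- The GNS construction: every state of a C*-algebra is a coefficient of a cyclic vector. -/
lemma IsState.exists_cyclic {ω : StrongDual ℂ A} (hω : IsState (ω : A →ₗ[ℂ] ℂ)) :
    ∃ (K : Type u) (_ : NormedAddCommGroup K) (_ : InnerProductSpace ℂ K) (_ : CompleteSpace K)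
      (π : A →⋆ₐ[ℂ] (K →L[ℂ] K)) (Ω : K), ω = vecFun π Ω Ω ∧ DenseRange fun a => π a Ω := by
  let _ : PartialOrder A := CStarAlgebra.spectralOrder A
  have _ : StarOrderedRing A := CStarAlgebra.spectralOrderedRing A
  let f : A →ₚ[ℂ] ℂ := PositiveLinearMap.mk₀ (ω : A →ₗ[ℂ] ℂ) fun a ha => by
    obtain ⟨b, rfl⟩ := CStarAlgebra.nonneg_iff_eq_star_mul_self.1 ha
    exact hω.nonneg b
  have hmul : ∀ a, f.gnsStarAlgHom a (f.toPreGNS 1 : Completion f.PreGNS) =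
      (f.toPreGNS a : Completion f.PreGNS) := fun a => by
    simp
  refine ⟨f.GNS, inferInstance, inferInstance, inferInstance, f.gnsStarAlgHom,
    (f.toPreGNS 1 : Completion f.PreGNS), ?_, ?_⟩
  · ext a
    rw [vecFun_apply, hmul, Completion.inner_coe, PositiveLinearMap.preGNS_inner_def]
    change ω a = ω (star 1 * a)
    rw [star_one, one_mul]
  · simp only [hmul]
    exact Completion.denseRange_coe.comp f.toPreGNS.surjective.denseRange
      (Completion.continuous_coe _)

/-- Positivity bounds `|ω(a)|` by `|ω(1)| ‖a‖` for `a ≥ 0`, and positive elements span the algebra.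
-/
lemma eq_zero_of_map_one_eq_zero {ω : StrongDual ℂ A} (hω : ∀ a, 0 ≤ ω (star a * a))
    (h : ω 1 = 0) : ω = 0 := by
  let _ : PartialOrder A := CStarAlgebra.spectralOrder A
  have _ : StarOrderedRing A := CStarAlgebra.spectralOrderedRing A
  let f : A →ₚ[ℂ] ℂ := PositiveLinearMap.mk₀ (ω : A →ₗ[ℂ] ℂ) fun a ha => by
    obtain ⟨b, rfl⟩ := CStarAlgebra.nonneg_iff_eq_star_mul_self.1 ha
    exact hω b
  have hpos : ∀ a, 0 ≤ a → ω a = 0 := fun a ha => by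
    have h1 : ‖ω a‖ ≤ ‖ω 1‖ * ‖a‖ := f.norm_apply_le_of_nonneg a ha
    simpa [h] using h1
  ext a
  obtain ⟨b, hb, -, hab⟩ := CStarAlgebra.exists_sum_four_nonneg a
  rw [hab, map_sum]
  refine Finset.sum_eq_zero fun k _ => ?_
  rw [map_smul, hpos _ (hb k), smul_zero]

end GNS

/-! ### Regularity in representations of the Weyl algebra. -/

section RegularStates

variable {E : Type u} [AddCommGroup E] [Module ℝ E] {σ : SymplecticForm E} {ħ : ℝ}

lemma WeylAlgebra.weyl_mul (F G : E) :
    WeylAlgebra.weyl σ ħ F * WeylAlgebra.weyl σ ħ G =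
      σ.phase ħ F G • WeylAlgebra.weyl σ ħ (F + G) := by
  have h : WeylSpan.weyl σ ħ F * WeylSpan.weyl σ ħ G =
      σ.phase ħ F G • WeylSpan.weyl σ ħ (F + G) := by
    simp only [WeylSpan.weyl, WeylSpan.single_mul_single, WeylSpan.smul_single, one_mul, mul_one]
  exact (UniformSpace.Completion.coe_mul _ _).symm.trans
    ((congrArg _ h).trans (UniformSpace.Completion.coe_smul _ _))

lemma WeylAlgebra.star_weyl (F : E) :
    star (WeylAlgebra.weyl σ ħ F) = WeylAlgebra.weyl σ ħ (-F) := by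
  refine (completion_coe_star _).trans (congrArg _ ?_)
  rw [WeylSpan.weyl, WeylSpan.star_single, star_one]
  rfl

lemma WeylAlgebra.weyl_zero : WeylAlgebra.weyl σ ħ 0 = 1 := rfl

lemma WeylAlgebra.star_weyl_mul_weyl_smul (F : E) (s t : ℝ) :
    star (WeylAlgebra.weyl σ ħ (s • F)) * WeylAlgebra.weyl σ ħ (t • F) =
      WeylAlgebra.weyl σ ħ ((t - s) • F) := by
  rw [WeylAlgebra.star_weyl, WeylAlgebra.weyl_mul]
  have h : σ.phase ħ (-(s • F)) (t • F) = 1 := by simp [SymplecticForm.phase, σ.alt]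
  rw [h, one_smul, sub_smul, neg_add_eq_sub]

/-- The linear span of the Weyl elements is dense in the Weyl algebra. -/
lemma WeylAlgebra.dense_span_weyl :
    Dense (Submodule.span ℂ (Set.range (WeylAlgebra.weyl σ ħ)) : Set (WeylAlgebra σ ħ)) := by
  refine (UniformSpace.Completion.denseRange_coe (α := WeylSpan σ ħ)).mono ?_
  rintro _ ⟨a, rfl⟩
  induction a using WeylSpan.induction with
  | h0 => exact Submodule.zero_mem _
  | hadd a b ha hb =>
    rw [UniformSpace.Completion.coe_add]
    exact Submodule.add_mem _ ha hb
  | hs F c =>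
    have h : WeylSpan.single σ ħ F c = c • WeylSpan.weyl σ ħ F := by
      rw [WeylSpan.weyl, WeylSpan.smul_single, mul_one]
    have h' : ((WeylSpan.single σ ħ F c : WeylSpan σ ħ) :
        UniformSpace.Completion (WeylSpan σ ħ)) = (c • WeylAlgebra.weyl σ ħ F : WeylAlgebra σ ħ) :=
      (congrArg _ h).trans (UniformSpace.Completion.coe_smul _ _)
    rw [h']
    exact Submodule.smul_mem (M := WeylAlgebra σ ħ) _ c (Submodule.subset_span ⟨F, rfl⟩)

variable {K : Type*} [NormedAddCommGroup K] [InnerProductSpace ℂ K] [CompleteSpace K]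
  (π : WeylAlgebra σ ħ →⋆ₐ[ℂ] (K →L[ℂ] K))

lemma norm_rep_weyl_apply (F : E) (ξ : K) : ‖π (WeylAlgebra.weyl σ ħ F) ξ‖ = ‖ξ‖ := by
  have h : ⟪π (WeylAlgebra.weyl σ ħ F) ξ, π (WeylAlgebra.weyl σ ħ F) ξ⟫_ℂ = ⟪ξ, ξ⟫_ℂ := by
    have h1 := WeylAlgebra.star_weyl_mul_weyl_smul (σ := σ) (ħ := ħ) F 1 1
    rw [one_smul, sub_self, zero_smul, WeylAlgebra.weyl_zero] at h1
    rw [← inner_rep_star, ← mul_apply_eq_comp, ← map_mul, h1, map_one]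
    rfl
  rw [inner_self_eq_norm_sq_to_K, inner_self_eq_norm_sq_to_K] at h
  have h2 : ‖π (WeylAlgebra.weyl σ ħ F) ξ‖ ^ 2 = ‖ξ‖ ^ 2 := by exact_mod_cast h
  exact (sq_eq_sq₀ (norm_nonneg _) (norm_nonneg _)).1 h2

/-- The vectors on which `t ↦ π(W(tF))` is continuous. -/
def continuousVectors (F : E) : Submodule ℂ K where
  carrier := {ξ | Continuous fun t : ℝ => π (WeylAlgebra.weyl σ ħ (t • F)) ξ}
  add_mem' := fun {ξ η} hξ hη => by
    have : Continuous fun t : ℝ => π (WeylAlgebra.weyl σ ħ (t • F)) ξ +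
      π (WeylAlgebra.weyl σ ħ (t • F)) η := Continuous.add hξ hη
    simpa only [Set.mem_ofPred_eq, map_add] using this
  zero_mem' := by
    simpa only [Set.mem_ofPred_eq, map_zero] using continuous_const
  smul_mem' := fun c ξ hξ => by
    have : Continuous fun t : ℝ => c • π (WeylAlgebra.weyl σ ħ (t • F)) ξ :=
      Continuous.const_smul hξ c
    simpa only [Set.mem_ofPred_eq, map_smul] using this

lemma mem_continuousVectors {F : E} {ξ : K} : ξ ∈ continuousVectors π F ↔
    Continuous fun t : ℝ => π (WeylAlgebra.weyl σ ħ (t • F)) ξ := Iff.rfl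

/-- The Weyl operators are isometric, so approximation of vectors is uniform in `t`. -/
lemma isClosed_continuousVectors (F : E) : IsClosed (continuousVectors π F : Set K) := by
  refine closure_subset_iff_isClosed.1 fun ξ hξ => ?_
  refine Metric.continuous_iff'.2 ?_
  intro t ε hε
  obtain ⟨η, hη, hξη⟩ := Metric.mem_closure_iff.1 hξ (ε / 3) (by positivity)
  filter_upwards [Metric.continuous_iff'.1 (show Continuous fun t : ℝ =>
    π (WeylAlgebra.weyl σ ħ (t • F)) η from hη) t (ε / 3) (by positivity)] with s hs
  have h1 : ∀ r : ℝ, dist (π (WeylAlgebra.weyl σ ħ (r • F)) ξ)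
      (π (WeylAlgebra.weyl σ ħ (r • F)) η) < ε / 3 := fun r => by
    rwa [dist_eq_norm, ← map_sub, norm_rep_weyl_apply, ← dist_eq_norm]
  have h2 := dist_triangle4 (π (WeylAlgebra.weyl σ ħ (s • F)) ξ)
    (π (WeylAlgebra.weyl σ ħ (s • F)) η) (π (WeylAlgebra.weyl σ ħ (t • F)) η)
    (π (WeylAlgebra.weyl σ ħ (t • F)) ξ)
  have h3 := h1 t
  rw [dist_comm] at h3
  linarith [h1 s]

/-- Commuting `W(tF)` past `W(G)` costs only the phase `e^{-iħtσ(F,G)}`, which is continuous in `t`.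
-/
lemma rep_weyl_mem_continuousVectors {F : E} {ξ : K} (h : ξ ∈ continuousVectors π F) (G : E) :
    π (WeylAlgebra.weyl σ ħ G) ξ ∈ continuousVectors π F := by
  have hcomm : ∀ t : ℝ, π (WeylAlgebra.weyl σ ħ (t • F)) (π (WeylAlgebra.weyl σ ħ G) ξ) =
      Complex.exp (-(Complex.I * ħ) * ((t * σ.form F G : ℝ) : ℂ)) •
        π (WeylAlgebra.weyl σ ħ G) (π (WeylAlgebra.weyl σ ħ (t • F)) ξ) := by
    intro t
    rw [← mul_apply_eq_comp, ← mul_apply_eq_comp, ← map_mul, ← map_mul,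
      WeylAlgebra.weyl_mul, WeylAlgebra.weyl_mul, map_smul, map_smul, smul_apply, smul_apply,
      smul_smul, add_comm G]
    congr 1
    rw [SymplecticForm.phase, SymplecticForm.phase, ← Complex.exp_add, σ.form_swap G (t • F)]
    congr 1
    simp
    ring
  rw [mem_continuousVectors]
  simp only [hcomm]
  have h' : Continuous fun t : ℝ => π (WeylAlgebra.weyl σ ħ (t • F)) ξ := h
  have h'' := (π (WeylAlgebra.weyl σ ħ G)).continuous.comp h'
  exact Continuous.smul (by fun_prop) h''

/-- Weak continuity of a unitary group implies strong continuity: the squared distance between two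
translates of `Ω` depends only on the real part of one coefficient. -/
lemma mem_continuousVectors_of_regular {Ω : K} (F : E)
    (h : Continuous fun t : ℝ => ⟪Ω, π (WeylAlgebra.weyl σ ħ (t • F)) Ω⟫_ℂ) :
    Ω ∈ continuousVectors π F := by
  refine continuous_iff_continuousAt.2 fun s => ?_
  refine tendsto_iff_norm_sub_tendsto_zero.2 ?_
  have h1 : ∀ t : ℝ, ‖π (WeylAlgebra.weyl σ ħ (t • F)) Ω - π (WeylAlgebra.weyl σ ħ (s • F)) Ω‖ =
      √(2 * ‖Ω‖ ^ 2 - 2 * (⟪Ω, π (WeylAlgebra.weyl σ ħ ((s - t) • F)) Ω⟫_ℂ).re) := by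
    intro t
    rw [← Real.sqrt_sq (norm_nonneg (_ - _)), norm_sub_sq (𝕜 := ℂ), norm_rep_weyl_apply,
      norm_rep_weyl_apply, ← inner_rep_star, ← mul_apply_eq_comp, ← map_mul,
      WeylAlgebra.star_weyl_mul_weyl_smul]
    congr 1
    change ‖Ω‖ ^ 2 - 2 * (⟪Ω, π (WeylAlgebra.weyl σ ħ ((s - t) • F)) Ω⟫_ℂ).re + ‖Ω‖ ^ 2 = _
    ring
  have h2 : Continuous fun t : ℝ =>
      √(2 * ‖Ω‖ ^ 2 - 2 * (⟪Ω, π (WeylAlgebra.weyl σ ħ ((s - t) • F)) Ω⟫_ℂ).re) := by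
    have h3 := h.comp (continuous_const.sub continuous_id : Continuous fun t : ℝ => s - t)
    have h4 := Complex.continuous_re.comp h3
    exact (continuous_const.sub (continuous_const.mul h4)).sqrt
  simp only [h1]
  have h5 := h2.tendsto s
  rw [sub_self, zero_smul, WeylAlgebra.weyl_zero, map_one] at h5
  have h6 : (⟪Ω, (1 : K →L[ℂ] K) Ω⟫_ℂ).re = ‖Ω‖ ^ 2 := by
    have := inner_self_eq_norm_sq (𝕜 := ℂ) Ω
    simpa using this
  rw [h6, sub_self, Real.sqrt_zero] at h5
  exact h5

/-- The continuous vectors form a closed subspace that contains `Ω` and is stable under the Weyl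
operators, whose span is dense in the algebra; cyclicity of `Ω` finishes. -/
lemma continuousVectors_eq_top {Ω : K} (hΩ : DenseRange fun a => π a Ω) (F : E)
    (h : Continuous fun t : ℝ => ⟪Ω, π (WeylAlgebra.weyl σ ħ (t • F)) Ω⟫_ℂ) (ξ : K) :
    ξ ∈ continuousVectors π F := by
  have hc := isClosed_continuousVectors π F
  have h0 := mem_continuousVectors_of_regular π F h
  have hπ : Continuous fun a => π a Ω := by
    have : Continuous π := AddMonoidHomClass.continuous_of_bound π 1 fun a => by
      simpa using norm_rep_le π a
    exact this.clm_apply continuous_const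
  have h1 : ∀ a, π a Ω ∈ continuousVectors π F := fun a => by
    refine closure_minimal (s := (Submodule.span ℂ (Set.range (WeylAlgebra.weyl σ ħ)) : Set _))
      (t := (fun a => π a Ω) ⁻¹' continuousVectors π F) ?_ (hc.preimage hπ)
      (WeylAlgebra.dense_span_weyl a)
    intro a ha
    change π a Ω ∈ continuousVectors π F
    induction ha using Submodule.span_induction with
    | zero => rw [map_zero]; exact Submodule.zero_mem _
    | add a b _ _ ha hb => rw [map_add]; exact Submodule.add_mem _ ha hb
    | smul c a _ ha => rw [map_smul]; exact Submodule.smul_mem _ c ha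
    | mem a ha =>
      obtain ⟨G, rfl⟩ := ha
      exact rep_weyl_mem_continuousVectors π h0 G
  exact closure_minimal (Set.range_subset_iff.2 h1) hc (hΩ ξ)

/-- The cone of regular positive functionals. -/
def regularPositive (σ : SymplecticForm E) (ħ : ℝ) : Set (StrongDual ℂ (WeylAlgebra σ ħ)) :=
  {ω | (∀ a, 0 ≤ ω (star a * a)) ∧
    ∀ F : E, Continuous fun t : ℝ => ω (WeylAlgebra.weyl σ ħ (t • F))}

lemma isClosed_regularPositive : IsClosed (regularPositive σ ħ) := by
  refine closure_subset_iff_isClosed.1 fun ω hω => ⟨fun a => ?_, fun F => ?_⟩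
  · have hc : IsClosed {ω : StrongDual ℂ (WeylAlgebra σ ħ) | 0 ≤ ω (star a * a)} :=
      isClosed_le continuous_const (ContinuousLinearMap.apply ℂ ℂ (star a * a)).continuous
    exact closure_minimal (fun ω hω => hω.1 a) hc hω
  · refine continuous_of_uniform_approx_of_continuous fun u hu => ?_
    obtain ⟨ε, hε, hεu⟩ := Metric.mem_uniformity_dist.1 hu
    -- A bound independent of `t` turns norm convergence of functionals into uniform convergence of
    -- `t ↦ ω(W(tF))`.
    obtain ⟨C, hC0, hC⟩ : ∃ C > 0, ∀ t : ℝ, ‖WeylAlgebra.weyl σ ħ (t • F)‖ ≤ C := by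
      refine ⟨1, one_pos, fun t => ?_⟩
      have h1 := WeylAlgebra.star_weyl_mul_weyl_smul (σ := σ) (ħ := ħ) F t t
      rw [sub_self, zero_smul, WeylAlgebra.weyl_zero] at h1
      have h2 := CStarRing.norm_star_mul_self (x := WeylAlgebra.weyl σ ħ (t • F))
      rw [h1] at h2
      have h3 : ‖(1 : WeylAlgebra σ ħ)‖ ≤ 1 := by
        have h4 := CStarRing.norm_star_mul_self (x := (1 : WeylAlgebra σ ħ))
        rw [star_one, one_mul] at h4
        nlinarith [norm_nonneg (1 : WeylAlgebra σ ħ)]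
      nlinarith [norm_nonneg (WeylAlgebra.weyl σ ħ (t • F))]
    obtain ⟨ρ, hρ, hωρ⟩ := Metric.mem_closure_iff.1 hω (ε / C) (by positivity)
    refine ⟨_, hρ.2 F, fun t => hεu ?_⟩
    rw [dist_eq_norm, ← sub_apply]
    rw [dist_eq_norm, lt_div_iff₀ hC0] at hωρ
    exact ((ContinuousLinearMap.le_opNorm _ _).trans
      (mul_le_mul_of_nonneg_left (hC t) (norm_nonneg _))).trans_lt hωρ

lemma vecFun_mem_regularPositive {Ω : K} (hΩ : DenseRange fun a => π a Ω)
    (h : IsRegularState σ ħ (vecFun π Ω Ω)) (ξ : K) :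
    vecFun π ξ ξ ∈ regularPositive σ ħ := by
  refine ⟨fun a => ?_, fun F => ?_⟩
  · rw [vecFun_apply, map_mul, mul_apply_eq_comp, inner_rep_star]
    exact RCLike.nonneg_iff.2 ⟨inner_self_nonneg, inner_self_im _⟩
  · have h1 := (mem_continuousVectors π).1 (continuousVectors_eq_top π hΩ F (h.continuous_weyl F) ξ)
    exact continuous_const.inner h1

/-- Either `ω` vanishes or division by `ω(1)` makes it a regular state. -/
lemma regularPositive_subset {ω : StrongDual ℂ (WeylAlgebra σ ħ)} (h : ω ∈ regularPositive σ ħ) :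
    ω ∈ regularFunctionals σ ħ := by
  have h1 : 0 ≤ ω 1 := by simpa using h.1 1
  have hre : ω 1 = ((ω 1).re : ℂ) :=
    Complex.ext rfl (by rw [Complex.ofReal_im]; exact (Complex.nonneg_iff.1 h1).2.symm)
  rcases eq_or_ne (ω 1) 0 with h0 | h0
  · rw [eq_zero_of_map_one_eq_zero h.1 h0]
    exact Submodule.zero_mem _
  · have hst : IsRegularState σ ħ ((ω 1)⁻¹ • ω) := by
      refine ⟨⟨fun a => ?_, ?_⟩, fun F => ?_⟩
      · exact mul_nonneg (inv_nonneg.2 h1) (h.1 a)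
      · exact inv_mul_cancel₀ h0
      · exact continuous_const.mul (h.2 F)
    have h2 := (regularFunctionals σ ħ).smul_mem (ω 1) (Submodule.subset_span hst)
    rwa [smul_smul, mul_inv_cancel₀ h0, one_smul] at h2

end RegularStates

/-! ### Identification of `𝔄_ħ` with the dual of `V_ħ`. -/

section Main

variable {E : Type u} [AddCommGroup E] [Module ℝ E] {σ : SymplecticForm E} {ħ : ℝ}

/-- Polarisation writes each coefficient in terms of positive regular functionals; conversely each
regular state is a coefficient of its own GNS representation. -/
lemma coefficientSpace_eq_regularFunctionals
    {K : {ω // IsRegularState σ ħ ω} → Type u}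
    [∀ i, NormedAddCommGroup (K i)] [∀ i, InnerProductSpace ℂ (K i)] [∀ i, CompleteSpace (K i)]
    (π : ∀ i, WeylAlgebra σ ħ →⋆ₐ[ℂ] (K i →L[ℂ] K i)) (Ω : ∀ i, K i)
    (hω : ∀ i, i.1 = vecFun (π i) (Ω i) (Ω i))
    (hmem : ∀ i ξ, vecFun (π i) ξ ξ ∈ regularPositive σ ħ) :
    coefficientSpace π = regularFunctionals σ ħ := by
  refine le_antisymm (Submodule.span_le.2 ?_) (Submodule.span_le.2 fun ω h => ?_)
  · rintro _ ⟨i, ξ, η, rfl⟩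
    rw [vecFun_eq_quadComb]
    exact quadComb_mem _ fun k => Submodule.smul_mem _ _ (regularPositive_subset (hmem i _))
  · have h1 : ω = vecFun (π ⟨ω, h⟩) (Ω ⟨ω, h⟩) (Ω ⟨ω, h⟩) := hω ⟨ω, h⟩
    rw [h1]
    exact vecFun_mem_coefficientSpace π _ _ _

/-- The GNS representations of all regular states form a family of representations whose
coefficients span the space of regular functionals. -/
lemma exists_family_coefficientSpace_eq (σ : SymplecticForm E) (ħ : ℝ) :
    ∃ (K : {ω // IsRegularState σ ħ ω} → Type u) (_ : ∀ i, NormedAddCommGroup (K i))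
      (_ : ∀ i, InnerProductSpace ℂ (K i)) (_ : ∀ i, CompleteSpace (K i))
      (π : ∀ i, WeylAlgebra σ ħ →⋆ₐ[ℂ] (K i →L[ℂ] K i)),
      (∀ i ξ, vecFun (π i) ξ ξ ∈ regularPositive σ ħ) ∧
        coefficientSpace π = regularFunctionals σ ħ := by
  have key := fun i : {ω // IsRegularState σ ħ ω} => i.2.isState.exists_cyclic
  choose K i1 i2 i3 π Ω hω hΩ using key
  have hmem : ∀ i ξ, vecFun (π i) ξ ξ ∈ regularPositive σ ħ := fun i =>
    vecFun_mem_regularPositive (π i) (hΩ i) (hω i ▸ i.2)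
  exact ⟨K, i1, i2, i3, π, hmem, coefficientSpace_eq_regularFunctionals π Ω hω hmem⟩

/-- The inclusion of the regular functionals in the dual, as a linear isometry. -/
def RegularFunctional.valₗᵢ (σ : SymplecticForm E) (ħ : ℝ) :
    RegularFunctional σ ħ →ₗᵢ[ℂ] StrongDual ℂ (WeylAlgebra σ ħ) where
  toFun := RegularFunctional.val σ ħ
  map_add' _ _ := rfl
  map_smul' _ _ := rfl
  norm_map' _ := rfl

lemma exists_valₗᵢ_eq_iff (ω : StrongDual ℂ (WeylAlgebra σ ħ)) :
    ω ∈ regularFunctionals σ ħ ↔ ∃ x, RegularFunctional.valₗᵢ σ ħ x = ω :=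
  ⟨fun h => ⟨(⟨ω, h⟩ : regularFunctionals σ ħ), rfl⟩, by rintro ⟨x, rfl⟩; exact x.2⟩

/-- Vanishing at a fixed `Φ` is a weak* closed condition, so taking the closure imposes nothing new.
-/
lemma mem_annihilatorOfClosure_iff {A : Type u} [CStarAlgebra A] {V : Set (StrongDual ℂ A)}
    {Φ : Bidual A} : Φ ∈ annihilatorOfClosure V ↔ ∀ ω ∈ V, Φ ω = 0 := by
  refine ⟨fun h ω hω => h _ (subset_closure ⟨ω, hω, rfl⟩), fun h ξ hξ => ?_⟩
  have hc : IsClosed {ξ : WeakDual ℂ (Bidual A) | ξ Φ = 0} :=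
    isClosed_eq (WeakDual.eval_continuous Φ) continuous_const
  refine closure_minimal ?_ hc hξ
  rintro _ ⟨ω, hω, rfl⟩
  exact h ω hω

lemma sub_mem_regularAnnihilator_iff {Φ Ψ : Bidual (WeylAlgebra σ ħ)} :
    Φ - Ψ ∈ regularAnnihilator σ ħ ↔ restrictFunctional (RegularFunctional.valₗᵢ σ ħ) Φ =
      restrictFunctional (RegularFunctional.valₗᵢ σ ħ) Ψ := by
  rw [regularAnnihilator, mem_annihilatorOfClosure_iff]
  refine ⟨fun h => ContinuousLinearMap.ext fun x => sub_eq_zero.1 (h _ x.2), fun h ω hω => ?_⟩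
  exact sub_eq_zero.2 (DFunLike.congr_fun h (⟨ω, hω⟩ : regularFunctionals σ ħ))

/-- The restriction of functionals to `V_ħ` identifies `𝔄_ħ` with the dual of `V_ħ`. -/
def RegularQuotient.equivDual (σ : SymplecticForm E) (ħ : ℝ) :
    RegularQuotient σ ħ ≃ StrongDual ℂ (RegularFunctional σ ħ) where
  toFun := Quotient.lift (restrictFunctional (RegularFunctional.valₗᵢ σ ħ)) fun Φ Ψ h =>
    sub_mem_regularAnnihilator_iff.1
      ((RegularQuotient.mk_eq_mk_iff σ ħ Φ Ψ).1 (Quotient.sound h))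
  invFun f := RegularQuotient.mk σ ħ (extendFunctional (RegularFunctional.valₗᵢ σ ħ) f)
  left_inv q := by
    obtain ⟨Φ, rfl⟩ := RegularQuotient.mk_surjective σ ħ q
    exact (RegularQuotient.mk_eq_mk_iff σ ħ _ _).2
      (sub_mem_regularAnnihilator_iff.2 (restrictFunctional_extendFunctional _))
  right_inv f := restrictFunctional_extendFunctional f

/-- The distance of a functional to the annihilator of a subspace is the norm of its
restriction. -/
lemma norm_comp_eq_infDist {X 𝔼 : Type*} [NormedAddCommGroup X] [NormedSpace ℂ X]
    [NormedAddCommGroup 𝔼] [NormedSpace ℂ 𝔼] (v : X →ₗᵢ[ℂ] 𝔼) {S : Set (StrongDual ℂ 𝔼)}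
    (hS : ∀ f, f ∈ S ↔ ∀ x, f (v x) = 0) (f : StrongDual ℂ 𝔼) :
    ‖f.comp v.toContinuousLinearMap‖ = Metric.infDist f S := by
  refine le_antisymm ?_ ?_
  · refine (Metric.le_infDist ⟨0, (hS 0).2 fun x => rfl⟩).2 fun g hg => ?_
    rw [dist_eq_norm]
    refine ContinuousLinearMap.opNorm_le_bound _ (norm_nonneg _) fun x => ?_
    have h := (f - g).le_opNorm (v x)
    rwa [sub_apply, (hS g).1 hg x, sub_zero, v.norm_map] at h
  · obtain ⟨g, hg, hn⟩ := exists_extension_of_linearIsometry v (f.comp v.toContinuousLinearMap)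
    have h : f - g ∈ S := (hS _).2 fun x => by
      rw [sub_apply, hg]
      exact sub_self _
    refine (Metric.infDist_le_dist_of_mem h).trans ?_
    rw [dist_eq_norm, sub_sub_cancel, hn]

/-- The product on the dual may be computed from arbitrary representatives. This makes the Arens
product descend to the quotient. -/
lemma restrictFunctional_bidualMul {ι : Type*} {K : ι → Type*}
    [∀ i, NormedAddCommGroup (K i)] [∀ i, InnerProductSpace ℂ (K i)] [∀ i, CompleteSpace (K i)]
    {A : Type u} [CStarAlgebra A] {π : ∀ i, A →⋆ₐ[ℂ] (K i →L[ℂ] K i)}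
    {X : Type*} [NormedAddCommGroup X] [NormedSpace ℂ X] {v : X →ₗᵢ[ℂ] StrongDual ℂ A}
    (h : ∀ ω, ω ∈ coefficientSpace π ↔ ∃ x, v x = ω) (Φ Ψ : Bidual A) :
    restrictFunctional v (bidualMul Φ Ψ) =
      dualProduct v (restrictFunctional v Φ) (restrictFunctional v Ψ) :=
  dualRep_ext h fun i => by
    simp only [dualRep_product h, dualRep_restrictFunctional h, bidualRep_mul]

lemma restrictFunctional_bidualStar {ι : Type*} {K : ι → Type*}
    [∀ i, NormedAddCommGroup (K i)] [∀ i, InnerProductSpace ℂ (K i)] [∀ i, CompleteSpace (K i)]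
    {A : Type u} [CStarAlgebra A] {π : ∀ i, A →⋆ₐ[ℂ] (K i →L[ℂ] K i)}
    {X : Type*} [NormedAddCommGroup X] [NormedSpace ℂ X] {v : X →ₗᵢ[ℂ] StrongDual ℂ A}
    (h : ∀ ω, ω ∈ coefficientSpace π ↔ ∃ x, v x = ω) (Φ : Bidual A) :
    restrictFunctional v (bidualStar Φ) = dualInvolution v (restrictFunctional v Φ) :=
  dualRep_ext h fun i => by
    simp only [dualRep_involution h, dualRep_restrictFunctional h, bidualRep_star]

end Main

end

theorem mainTheorem7 {E : Type u} [AddCommGroup E] [Module ℝ E] (σ : SymplecticForm E)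
    (ħ : ℝ) (hħ : ħ ∈ Set.Icc (0 : ℝ) 1) :
    ∃ inst : CStarAlgebra (RegularQuotient σ ħ),
      IsInducedStructure σ ħ inst ∧
      WStarAlgebra (RegularQuotient σ ħ) ∧
      CompleteSpace (RegularFunctional σ ħ) ∧
      ∃ T : RegularQuotient σ ħ ≃ₗᵢ[ℂ] StrongDual ℂ (RegularFunctional σ ħ),
        ∀ (Φ : Bidual (WeylAlgebra σ ħ)) (ω : RegularFunctional σ ħ),
          T (RegularQuotient.mk σ ħ Φ) ω = Φ (RegularFunctional.val σ ħ ω) := by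
  obtain ⟨K, _, _, _, π, hmem, hspace⟩ := exists_family_coefficientSpace_eq σ ħ
  have h : ∀ ω, ω ∈ coefficientSpace π ↔ ∃ x, RegularFunctional.valₗᵢ σ ħ x = ω := by
    rw [hspace]
    exact exists_valₗᵢ_eq_iff
  have hclosed : IsClosed (regularFunctionals σ ħ : Set (StrongDual ℂ (WeylAlgebra σ ħ))) := by
    rw [← hspace]
    refine isClosed_coefficientSpace π isClosed_regularPositive ?_ ?_ hmem ?_ fun ω hω => ?_
    · exact fun p hp q hq => ⟨fun a => add_nonneg (hp.1 a) (hq.1 a),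
        fun F => (hp.2 F).add (hq.2 F)⟩
    · exact fun p hp c hc => ⟨fun a => mul_nonneg (Complex.zero_le_real.2 hc) (hp.1 a),
        fun F => continuous_const.mul (hp.2 F)⟩
    · exact ⟨fun a => le_rfl, fun F => continuous_const⟩
    · rw [hspace]
      exact regularPositive_subset hω
  have hcomplete : CompleteSpace (RegularFunctional σ ħ) :=
    hclosed.completeSpace_coe
  let e := RegularQuotient.equivDual σ ħ
  let instDual := dualCStarAlgebra h
  let inst : CStarAlgebra (RegularQuotient σ ħ) := CStarAlgebra.ofEquiv e
  let T : RegularQuotient σ ħ ≃ₗᵢ[ℂ] StrongDual ℂ (RegularFunctional σ ħ) :=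
    { toFun := e
      invFun := e.symm
      left_inv := e.left_inv
      right_inv := e.right_inv
      map_add' := fun x y => e.apply_symm_apply _
      map_smul' := fun c x => e.apply_symm_apply _
      norm_map' := fun x => rfl }
  -- `WStarAlgebra` asks for a conjugate-linear isometry from the dual of the predual, hence the
  -- composition of `T.symm` with the involution.
  refine ⟨inst, ⟨?_, ?_, ?_, ?_, ?_⟩, ⟨⟨RegularFunctional σ ħ, inferInstance, inferInstance,
    hcomplete, ⟨T.symm.trans (starₗᵢ ℂ)⟩⟩⟩, hcomplete, T, fun Φ ω => rfl⟩
  · exact fun Φ Ψ => e.injective (e.apply_symm_apply _).symm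
  · exact fun c Φ => e.injective (e.apply_symm_apply _).symm
  · exact fun Φ Ψ => e.injective
      ((restrictFunctional_bidualMul h Φ Ψ).trans (e.apply_symm_apply _).symm)
  · exact fun Φ => e.injective
      ((restrictFunctional_bidualStar h Φ).trans (e.apply_symm_apply _).symm)
  · refine norm_comp_eq_infDist (RegularFunctional.valₗᵢ σ ħ) fun Φ => mem_annihilatorOfClosure_iff.trans ?_
    exact ⟨fun hΦ x => hΦ _ x.2, fun hΦ ω hω => hΦ (⟨ω, hω⟩ : regularFunctionals σ ħ)⟩
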